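/- Let $E$ and $X$ be elliptic curves over $\mathbb{C}$, given by nonsingular Weierstrass equations $y^2 + a_1xy + a_3y = x^3 + a_2x^2 + a_4x + a_6$, with groups of points $E(\mathbb{C})$, $X(\mathbb{C})$ (including the point at infinity, which is the identity). A meromorphic function on such a curve $S$ is a map $S(\mathbb{C}) \to \mathbb{P}^1(\mathbb{C}) = \mathbb{C}\cup\{\infty\}$ given by an element of the function field of $S$. For a point $P$, let $\mathcal{O}_P$ be the local ring of rational functions regular at $P$ and $M_P$ its ideal of functions vanishing at $P$; the ramification index of a meromorphic function $\beta$ at $P$ is the largest $e$ with $\beta - \beta(P) \in M_P^e$ (respectively $1/\beta \in M_P^e$ if $\beta(P)=\infty$). A point is critical if its ramification index is at least $2$, and a critical value is the value of $\beta$ at a critical point. A toroidal Belyĭ pair $(S,\beta)$ consists of an elliptic curve $S$ and a non-constant meromorphic function $\beta : S(\mathbb{C}) \to \mathbb{P}^1(\mathbb{C})$ all of whose critical values lie in $\{0,1,\infty\}$. An isogeny $\psi : E \to X$ is a morphism of algebraic curves that is a group homomorphism $E(\mathbb{C}) \to X(\mathbb{C})$. **Theorem.** Let $(X,\varphi)$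 be a toroidal Belyĭ pair, and put $G = \varphi^{-1}(\{0,1,\infty\}) \subseteq X(\mathbb{C})$. Let $\psi : E \to X$ be a non-constant isogeny of elliptic curves over $\mathbb{C}$, and put $\beta = \varphi\circ\psi$ and $\Gamma = \beta^{-1}(\{0,1,\infty\}) \subseteq E(\mathbb{C})$. Then: 1. $(E,\beta)$ is a toroidal Belyĭ pair. 2. If every element of $G$ is a torsion point of $X(\mathbb{C})$, then every element of $\Gamma$ is a torsion point of $E(\mathbb{C})$. 3. If $G$ is a subgroup of $X(\mathbb{C})$, then $\Gamma = \psi^{-1}(G)$ is a subgroup of $E(\mathbb{C})$. -/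

import Mathlib

open scoped OnePoint

namespace ToroidalBelyi

open WeierstrassCurve WeierstrassCurve.Affine

noncomputable section

/-- The coordinate function `x` in the function field of `E`. -/
def xFun (E : WeierstrassCurve.Affine ℂ) : E.FunctionField :=
  algebraMap E.CoordinateRing E.FunctionField (CoordinateRing.mk E (Polynomial.C Polynomial.X))

/-- The coordinate function `y` in the function field of `E`. -/
def yFun (E : WeierstrassCurve.Affine ℂ) : E.FunctionField :=
  algebraMap E.CoordinateRing E.FunctionField (CoordinateRing.mk E Polynomial.X)

/-- The constant function `c` in the function field of `E`. -/
def constFun (E : WeierstrassCurve.Affine ℂ) (c : ℂ) : E.FunctionField :=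
  algebraMap E.CoordinateRing E.FunctionField
    (CoordinateRing.mk E (Polynomial.C (Polynomial.C c)))

/-- Affine coordinates of the projective curve centred at a point: `(x - x₀, y - y₀)` at an affine
point `(x₀, y₀)`, and `(x / y, 1 / y)` (that is, `(X / Y, Z / Y)`) at the point at infinity. -/
def localCoord {E : WeierstrassCurve.Affine ℂ} : E.Point → Fin 2 → E.FunctionField
  | .zero => ![xFun E / yFun E, 1 / yFun E]
  | .some x₀ y₀ _ => ![xFun E - constFun E x₀, yFun E - constFun E y₀]

/-- The polynomial `p`, in the affine coordinates centred at `P`, as a rational function. -/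
def polyFun {E : WeierstrassCurve.Affine ℂ} (P : E.Point) :
    MvPolynomial (Fin 2) ℂ →+* E.FunctionField :=
  MvPolynomial.eval₂Hom
    ((algebraMap E.CoordinateRing E.FunctionField).comp
      ((CoordinateRing.mk E).comp (Polynomial.C.comp Polynomial.C)))
    (localCoord P)

/-- The local ring `𝒪_P` of rational functions that are regular at `P`: the quotients `p / q` of
polynomials in the coordinates centred at `P`, where `q` does not vanish at `P`. -/
def localRing {E : WeierstrassCurve.Affine ℂ} (P : E.Point) : Subring E.FunctionField where
  carrier := {r | ∃ p q : MvPolynomial (Fin 2) ℂ,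
    MvPolynomial.eval (0 : Fin 2 → ℂ) q ≠ 0 ∧ polyFun P q * r = polyFun P p}
  zero_mem' := ⟨0, 1, by simp, by simp⟩
  one_mem' := ⟨1, 1, by simp, by simp⟩
  add_mem' := by
    rintro a b ⟨p, q, hq, h⟩ ⟨p', q', hq', h'⟩
    refine ⟨q' * p + q * p', q * q', by rw [map_mul]; exact mul_ne_zero hq hq', ?_⟩
    rw [map_mul, map_add, map_mul, map_mul, ← h, ← h']
    ring
  mul_mem' := by
    rintro a b ⟨p, q, hq, h⟩ ⟨p', q', hq', h'⟩
    refine ⟨p * p', q * q', by rw [map_mul]; exact mul_ne_zero hq hq', ?_⟩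
    rw [map_mul, map_mul, ← h, ← h']
    ring
  neg_mem' := by
    rintro a ⟨p, q, hq, h⟩
    exact ⟨-p, q, hq, by rw [map_neg, ← h, mul_neg]⟩

theorem localCoord_mem {E : WeierstrassCurve.Affine ℂ} (P : E.Point) (i : Fin 2) :
    localCoord P i ∈ localRing P :=
  ⟨MvPolynomial.X i, 1, by simp, by simp [polyFun]⟩

/-- The ideal `M_P` of `𝒪_P`, generated by the two coordinates centred at `P`. Its power `M_P ^ e`
is generated by the monomials of degree `e` in these coordinates. -/
def pointIdeal {E : WeierstrassCurve.Affine ℂ} (P : E.Point) : Ideal (localRing P) :=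
  Ideal.span (Set.range fun i : Fin 2 => (⟨localCoord P i, localCoord_mem P i⟩ : localRing P))

/-- The rational function `r` is regular at `P` and lies in `M_P ^ e`. -/
def InPow {E : WeierstrassCurve.Affine ℂ} (P : E.Point) (e : ℕ) (r : E.FunctionField) : Prop :=
  ∃ h : r ∈ localRing P, (⟨r, h⟩ : localRing P) ∈ pointIdeal P ^ e

/-- The order of vanishing at `P` of a rational function that is regular at `P`: the largest `e`
such that `r ∈ M_P ^ e` (and `⊤` for the zero function). -/
def vanishingOrder {E : WeierstrassCurve.Affine ℂ} (P : E.Point) (r : E.FunctionField) : ℕ∞ :=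
  ⨆ e : {e : ℕ // InPow P e r}, ((e : ℕ) : ℕ∞)

open Classical in
/-- The value in `ℙ¹(ℂ) = ℂ ∪ {∞}` of a rational function at `P`: the number `c` such that `r - c`
is regular and vanishes at `P`, and `∞` if there is none, that is, if `r` is not regular at `P`. -/
def value {E : WeierstrassCurve.Affine ℂ} (r : E.FunctionField) (P : E.Point) : OnePoint ℂ :=
  if h : ∃ c : ℂ, InPow P 1 (r - constFun E c) then ((h.choose : ℂ) : OnePoint ℂ) else ∞

/-- The ramification index of `r` at `P`: the order of vanishing of `r - r(P)`, or of `1 / r` at a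
pole. -/
def ramificationIndex {E : WeierstrassCurve.Affine ℂ} (r : E.FunctionField) (P : E.Point) : ℕ∞ :=
  match value r P with
  | ∞ => vanishingOrder P r⁻¹
  | OnePoint.some c => vanishingOrder P (r - constFun E c)

/-- The critical values of a rational function: its values at points of ramification index at
least two. -/
def criticalValues {E : WeierstrassCurve.Affine ℂ} (r : E.FunctionField) : Set (OnePoint ℂ) :=
  {q | ∃ P : E.Point, 2 ≤ ramificationIndex r P ∧ value r P = q}

/-- The subset `{0, 1, ∞}` of `ℙ¹(ℂ)`. -/
def threePoints : Set (OnePoint ℂ) :=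
  {((0 : ℂ) : OnePoint ℂ), ((1 : ℂ) : OnePoint ℂ), ∞}

/-- `(E, β)` is a toroidal Belyĭ pair: `β : E(ℂ) → ℙ¹(ℂ)` is a non-constant meromorphic function
(the map given by an element of the function field) all of whose critical values lie in
`{0, 1, ∞}`. -/
def IsToroidalBelyiPair (E : WeierstrassCurve.Affine ℂ) [E.IsElliptic]
    (β : E.Point → OnePoint ℂ) : Prop :=
  (∃ P Q : E.Point, β P ≠ β Q) ∧
    ∃ r : E.FunctionField, (∀ P : E.Point, value r P = β P) ∧ criticalValues r ⊆ threePoints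

/-- The set `β⁻¹ {0, 1, ∞}` of quasi-critical points. -/
def quasiCriticalSet {E : WeierstrassCurve.Affine ℂ} (β : E.Point → OnePoint ℂ) : Set E.Point :=
  β ⁻¹' threePoints

/-- Homogeneous coordinates of a point of the projective curve. -/
def homCoord {E : WeierstrassCurve.Affine ℂ} : E.Point → Fin 3 → ℂ
  | .zero => ![0, 1, 0]
  | .some x y _ => ![x, y, 1]

/-- `ψ : E → X ⊆ ℙ²` is a morphism of projective curves: it is a rational map `[f₀ : f₁ : f₂]` with
`fᵢ` in the function field of `E`, regular at every point `P`, which means that after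
multiplication by a suitable rational function `g` all `g fᵢ` are regular at `P` and their values
at `P` are homogeneous coordinates of `ψ P`. -/
def IsMorphism {E X : WeierstrassCurve.Affine ℂ} (ψ : E.Point → X.Point) : Prop :=
  ∃ f : Fin 3 → E.FunctionField, ∀ P : E.Point, ∃ g : E.FunctionField,
    ∀ i : Fin 3, InPow P 1 (g * f i - constFun E (homCoord (ψ P) i))

/-- An isogeny: a morphism of curves that is a group homomorphism. -/
def IsIsogeny (E X : WeierstrassCurve.Affine ℂ) [E.IsElliptic] [X.IsElliptic]
    (ψ : E.Point → X.Point) : Prop :=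
  IsMorphism ψ ∧ ∀ P Q : E.Point, ψ (P + Q) = ψ P + ψ Q

end

end ToroidalBelyi

namespace ToroidalBelyi

open WeierstrassCurve WeierstrassCurve.Affine

noncomputable section

variable {E X : WeierstrassCurve.Affine ℂ}

/-! The core fact is that a non-constant isogeny has finite fibres and is unramified.

Finite fibres: if `f` gives `ψ` in homogeneous coordinates, then `f 2 / f 1` is a nonzero function
vanishing on the kernel, and a function with infinitely many zeros is zero (`eq_zero_of_infinite`).
Hence there is a field embedding `Φ` of function fields such that `Φ r` takes at `P` the value of
`r` at `ψ P` (`IsGivenBy.exists_isPullback`, `IsPullback.value_eq`). So `φ ∘ ψ` is meromorphic, and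
it is non-constant because `φ` cannot take one value at infinitely many points.

Unramifiedness is read off from the invariant differential ω = dx / (2y + a₁x + a₃), in the form of
its dual derivation D = `invDeriv`. D preserves every local ring, and a function vanishing at `P`
lies in M_P² exactly when its derivative vanishes at `P` (`InPow.invDeriv`,
`inPow_two_of_invDeriv`). One has D ∘ Φ = g · (Φ ∘ D) for a single function g. It is regular
everywhere, hence a constant k (`exists_eq_const_of_regular`), and k ≠ 0 because in characteristic
zero a function with a zero and zero derivative vanishes (`eq_zero_of_invDeriv_eq_zero`). Thus
ramification of `Φ r` at `P` over a finite value forces ramification of `r` at `ψ P`; the value ∞ is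
allowed anyway.

For torsion, some positive multiple of `P` lies in the finite kernel. The subgroup statement is a
preimage under a homomorphism. -/

/-! ### Homomorphisms out of the coordinate ring and the function field -/

/-- The inclusion of the constants in the function field. -/
def constHom (E : WeierstrassCurve.Affine ℂ) : ℂ →+* E.FunctionField :=
  (algebraMap E.CoordinateRing E.FunctionField).comp
      ((CoordinateRing.mk E).comp (Polynomial.C.comp Polynomial.C))

theorem constFun_eq (c : ℂ) : constFun E c = constHom E c := rfl

/-- The homomorphism out of the coordinate ring given by a solution of the Weierstrass equation. -/
def coordLift {B : Type*} [CommRing B] (ι : ℂ →+* B) (x y : B)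
    (h : y ^ 2 + ι E.a₁ * x * y + ι E.a₃ * y =
      x ^ 3 + ι E.a₂ * x ^ 2 + ι E.a₄ * x + ι E.a₆) : E.CoordinateRing →+* B :=
  AdjoinRoot.lift (Polynomial.eval₂RingHom ι x) y (by
    simp only [polynomial, Polynomial.eval₂_sub, Polynomial.eval₂_add, Polynomial.eval₂_mul,
      Polynomial.eval₂_pow, Polynomial.eval₂_X, Polynomial.eval₂_C, Polynomial.coe_eval₂RingHom]
    linear_combination h)

section coordLift

variable {B : Type*} [CommRing B] (ι : ℂ →+* B) (x y : B)
    (h : y ^ 2 + ι E.a₁ * x * y + ι E.a₃ * y =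
      x ^ 3 + ι E.a₂ * x ^ 2 + ι E.a₄ * x + ι E.a₆)

@[simp]
theorem coordLift_x :
    coordLift ι x y h (CoordinateRing.mk E (Polynomial.C Polynomial.X)) = x := by
  simp [coordLift]

@[simp]
theorem coordLift_y : coordLift ι x y h (CoordinateRing.mk E Polynomial.X) = y := by
  simp [coordLift]

@[simp]
theorem coordLift_const (c : ℂ) :
    coordLift ι x y h (CoordinateRing.mk E (Polynomial.C (Polynomial.C c))) = ι c := by
  simp [coordLift]

end coordLift

theorem coordinateRing_induction {p : E.CoordinateRing → Prop} (a : E.CoordinateRing)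
    (const : ∀ c, p (CoordinateRing.mk E (Polynomial.C (Polynomial.C c))))
    (x : p (CoordinateRing.mk E (Polynomial.C Polynomial.X)))
    (y : p (CoordinateRing.mk E Polynomial.X))
    (add : ∀ a b, p a → p b → p (a + b)) (mul : ∀ a b, p a → p b → p (a * b)) : p a := by
  obtain ⟨f, rfl⟩ := AdjoinRoot.mk_surjective a
  have hC (g : Polynomial ℂ) : p (CoordinateRing.mk E (Polynomial.C g)) := by
    induction g using Polynomial.induction_on' with
    | add f g hf hg => simpa using add _ _ hf hg
    | monomial n c =>
      rw [← Polynomial.C_mul_X_pow_eq_monomial, map_mul, map_mul]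
      refine mul _ _ (const c) ?_
      rw [map_pow, map_pow]
      induction n with
      | zero => simpa using const 1
      | succ n ih => rw [pow_succ]; exact mul _ _ ih x
  induction f using Polynomial.induction_on' with
  | add f g hf hg => simpa using add _ _ hf hg
  | monomial n c =>
    rw [← Polynomial.C_mul_X_pow_eq_monomial, map_mul]
    refine mul _ _ (hC c) ?_
    rw [map_pow]
    induction n with
    | zero => simpa using const 1
    | succ n ih => rw [pow_succ]; exact mul _ _ ih y

/-- Constants, `x` and `y` generate the field, so statements stable under the field operations need
checking only there. -/
theorem functionField_induction {p : E.FunctionField → Prop} (r : E.FunctionField)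
    (const : ∀ c, p (constFun E c)) (x : p (xFun E)) (y : p (yFun E))
    (add : ∀ a b, p a → p b → p (a + b)) (mul : ∀ a b, p a → p b → p (a * b))
    (inv : ∀ a, p a → p a⁻¹) : p r := by
  have hA (a : E.CoordinateRing) : p (algebraMap E.CoordinateRing E.FunctionField a) := by
    induction a using coordinateRing_induction with
    | const c => exact const c
    | x => exact x
    | y => exact y
    | add a b ha hb => rw [map_add]; exact add _ _ ha hb
    | mul a b ha hb => rw [map_mul]; exact mul _ _ ha hb
  obtain ⟨a, b, -, rfl⟩ := IsFractionRing.div_surjective (A := E.CoordinateRing) r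
  rw [div_eq_mul_inv]
  exact mul _ _ (hA a) (inv _ (hA b))

theorem equation_fun (E : WeierstrassCurve.Affine ℂ) :
    yFun E ^ 2 + constHom E E.a₁ * xFun E * yFun E + constHom E E.a₃ * yFun E =
      xFun E ^ 3 + constHom E E.a₂ * xFun E ^ 2 + constHom E E.a₄ * xFun E + constHom E E.a₆ := by
  have h : CoordinateRing.mk E E.polynomial = 0 := AdjoinRoot.mk_self
  replace h := congrArg (algebraMap E.CoordinateRing E.FunctionField) h
  simp only [polynomial, map_sub, map_add, map_mul, map_pow, map_zero] at h
  simp only [constHom, xFun, yFun, RingHom.comp_apply]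
  linear_combination h

theorem yFun_ne_zero (E : WeierstrassCurve.Affine ℂ) : yFun E ≠ 0 := by
  rw [yFun, Ne, IsFractionRing.to_map_eq_zero_iff]
  simpa [CoordinateRing.YClass] using CoordinateRing.YClass_ne_zero (W' := E) 0

/-! ### Values at a point -/

/-- Evaluation of elements of the coordinate ring at an affine point. -/
def evalPoint {x y : ℂ} (h : E.Equation x y) : E.CoordinateRing →+* ℂ :=
  coordLift (RingHom.id ℂ) x y (by simpa using (equation_iff x y).1 h)

/-- The polynomial `p` in the coordinates centred at an affine point. -/
def polyCoord (E : WeierstrassCurve.Affine ℂ) (x y : ℂ) :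
    MvPolynomial (Fin 2) ℂ →+* E.CoordinateRing :=
  MvPolynomial.eval₂Hom ((CoordinateRing.mk E).comp (Polynomial.C.comp Polynomial.C))
    ![CoordinateRing.mk E (Polynomial.C Polynomial.X) -
        CoordinateRing.mk E (Polynomial.C (Polynomial.C x)),
      CoordinateRing.mk E Polynomial.X - CoordinateRing.mk E (Polynomial.C (Polynomial.C y))]

theorem polyFun_C (P : E.Point) (c : ℂ) : polyFun P (MvPolynomial.C c) = constHom E c := by
  simp [polyFun, constHom]

theorem polyFun_X (P : E.Point) (i : Fin 2) : polyFun P (MvPolynomial.X i) = localCoord P i := by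
  simp [polyFun]

theorem algebraMap_polyCoord {x y : ℂ} (h : E.Nonsingular x y) (p : MvPolynomial (Fin 2) ℂ) :
    algebraMap _ E.FunctionField (polyCoord E x y p) = polyFun (Point.some x y h) p := by
  have : (algebraMap _ E.FunctionField).comp (polyCoord E x y) = polyFun (Point.some x y h) := by
    refine MvPolynomial.ringHom_ext (fun c => ?_) fun i => ?_
    · simp [polyCoord, polyFun_C, constHom]
    · rw [polyFun_X]
      fin_cases i <;> simp [polyCoord, localCoord, xFun, yFun, constFun]
  exact DFunLike.congr_fun this p

theorem evalPoint_polyCoord {x y : ℂ} (h : E.Equation x y) (p : MvPolynomial (Fin 2) ℂ) :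
    evalPoint h (polyCoord E x y p) = MvPolynomial.eval 0 p := by
  have : (evalPoint h).comp (polyCoord E x y) = MvPolynomial.eval 0 := by
    refine MvPolynomial.ringHom_ext (fun c => ?_) fun i => ?_
    · simp [polyCoord, evalPoint, -AdjoinRoot.mk_C, -AdjoinRoot.mk_X]
    · fin_cases i <;> simp [polyCoord, evalPoint, -AdjoinRoot.mk_C, -AdjoinRoot.mk_X]
  exact DFunLike.congr_fun this p

/-! ### Pole order at infinity -/

/-- The degree of an element of the coordinate ring: the order of its pole at infinity. -/
def coordDegree (a : E.CoordinateRing) : WithBot ℕ := (Algebra.norm (Polynomial ℂ) a).degree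

theorem coordDegree_mul (a b : E.CoordinateRing) :
    coordDegree (a * b) = coordDegree a + coordDegree b := by
  rw [coordDegree, map_mul, Polynomial.degree_mul]; rfl

theorem coordDegree_smul_basis (p q : Polynomial ℂ) :
    coordDegree (p • (1 : E.CoordinateRing) + q • CoordinateRing.mk E Polynomial.X) =
      max (2 • p.degree) (2 • q.degree + 3) :=
  CoordinateRing.degree_norm_smul_basis p q

theorem coordDegree_zero : coordDegree (0 : E.CoordinateRing) = ⊥ := by
  simpa using coordDegree_smul_basis (E := E) 0 0

/-- In the basis 1, y the degree is the maximum of the contributions of the two coefficients, and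
each contribution satisfies the ultrametric inequality. -/
theorem coordDegree_add_le (a b : E.CoordinateRing) :
    coordDegree (a + b) ≤ max (coordDegree a) (coordDegree b) := by
  obtain ⟨p, q, rfl⟩ := CoordinateRing.exists_smul_basis_eq a
  obtain ⟨p', q', rfl⟩ := CoordinateRing.exists_smul_basis_eq b
  have : (p • (1 : E.CoordinateRing) + q • CoordinateRing.mk E Polynomial.X) +
      (p' • (1 : E.CoordinateRing) + q' • CoordinateRing.mk E Polynomial.X) =
      (p + p') • (1 : E.CoordinateRing) + (q + q') • CoordinateRing.mk E Polynomial.X := by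
    simp only [add_smul]; ring
  rw [this, coordDegree_smul_basis, coordDegree_smul_basis, coordDegree_smul_basis]
  have h (p p' : Polynomial ℂ) : 2 • (p + p').degree ≤ max (2 • p.degree) (2 • p'.degree) := by
    rcases le_max_iff.1 (Polynomial.degree_add_le p p') with h | h
    · exact le_max_of_le_left (nsmul_le_nsmul_right h 2)
    · exact le_max_of_le_right (nsmul_le_nsmul_right h 2)
  refine max_le ((h p p').trans (max_le_max (le_max_left _ _) (le_max_left _ _))) ?_
  refine (add_le_add_left (h q q') 3).trans ?_
  rw [← max_add_add_right]
  exact max_le_max (le_max_right _ _) (le_max_right _ _)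

theorem coordDegree_const_le (c : ℂ) :
    coordDegree (CoordinateRing.mk E (Polynomial.C (Polynomial.C c))) ≤ 0 := by
  have := coordDegree_smul_basis (E := E) (Polynomial.C c) 0
  rw [zero_smul, add_zero, CoordinateRing.smul, mul_one] at this
  rw [this]
  refine max_le ?_ (by simp)
  exact (nsmul_le_nsmul_right Polynomial.degree_C_le 2).trans (by simp)

theorem coordDegree_const {c : ℂ} (hc : c ≠ 0) :
    coordDegree (CoordinateRing.mk E (Polynomial.C (Polynomial.C c))) = 0 := by
  have := coordDegree_smul_basis (E := E) (Polynomial.C c) 0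
  rw [zero_smul, add_zero, CoordinateRing.smul, mul_one] at this
  rw [this, Polynomial.degree_C hc]
  simp

theorem coordDegree_x :
    coordDegree (CoordinateRing.mk E (Polynomial.C Polynomial.X)) = 2 := by
  have := coordDegree_smul_basis (E := E) Polynomial.X 0
  rw [zero_smul, add_zero, CoordinateRing.smul, mul_one] at this
  rw [this, Polynomial.degree_X]
  simp

theorem coordDegree_y : coordDegree (CoordinateRing.mk E Polynomial.X) = 3 := by
  have := coordDegree_smul_basis (E := E) 0 1
  rw [zero_smul, zero_add, one_smul] at this
  rw [this, Polynomial.degree_one]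
  simp

theorem coordDegree_y_pow (n : ℕ) :
    coordDegree (CoordinateRing.mk E Polynomial.X ^ n) = (3 * n : ℕ) := by
  induction n with
  | zero => simp [coordDegree]
  | succ n ih => rw [pow_succ, coordDegree_mul, ih, coordDegree_y]; norm_cast

theorem coordDegree_mul_lt {a b : E.CoordinateRing} {m n : ℕ} (ha : coordDegree a < m)
    (hb : coordDegree b ≤ n) : coordDegree (a * b) < (m + n : ℕ) := by
  rw [coordDegree_mul]
  generalize coordDegree a = d at *
  generalize coordDegree b = e at *
  induction d with
  | bot => simp
  | coe d =>
    induction e with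
    | bot => simp
    | coe e =>
      have ha' : d < m := WithBot.coe_lt_coe.1 ha
      have hb' : e ≤ n := WithBot.coe_le_coe.1 hb
      exact WithBot.coe_lt_coe.2 (add_lt_add_of_lt_of_le ha' hb')

theorem coordDegree_mul_le {a b : E.CoordinateRing} {m n : ℕ} (ha : coordDegree a ≤ m)
    (hb : coordDegree b ≤ n) : coordDegree (a * b) ≤ (m + n : ℕ) := by
  rw [coordDegree_mul]
  exact_mod_cast add_le_add ha hb

theorem coordDegree_le_of_sub_lt {Q : E.CoordinateRing} {c : ℂ} {N : ℕ}
    (h : coordDegree (Q - CoordinateRing.mk E (Polynomial.C (Polynomial.C c)) *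
      CoordinateRing.mk E Polynomial.X ^ N) < (3 * N : ℕ)) : coordDegree Q ≤ (3 * N : ℕ) := by
  have := coordDegree_add_le (Q - CoordinateRing.mk E (Polynomial.C (Polynomial.C c)) *
      CoordinateRing.mk E Polynomial.X ^ N) (CoordinateRing.mk E (Polynomial.C (Polynomial.C c)) *
      CoordinateRing.mk E Polynomial.X ^ N)
  rw [sub_add_cancel] at this
  refine this.trans (max_le h.le ?_)
  have h0 := coordDegree_mul_le (m := 0) (coordDegree_const_le (E := E) c) (coordDegree_y_pow N).le
  rwa [zero_add] at h0

/-- A polynomial in `x / y` and `1 / y` is `Q / y ^ N`, where the term of degree `3 * N` in `Q`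
comes from the constant coefficient. -/
theorem exists_polyFun_zero (p : MvPolynomial (Fin 2) ℂ) :
    ∃ (N : ℕ) (Q : E.CoordinateRing),
      algebraMap _ E.FunctionField Q = yFun E ^ N * polyFun (0 : E.Point) p ∧
      coordDegree (Q - CoordinateRing.mk E (Polynomial.C (Polynomial.C (MvPolynomial.eval 0 p))) *
        CoordinateRing.mk E Polynomial.X ^ N) < (3 * N : ℕ) := by
  induction p using MvPolynomial.induction_on with
  | C c =>
    refine ⟨1, CoordinateRing.mk E (Polynomial.C (Polynomial.C c)) *
      CoordinateRing.mk E Polynomial.X, ?_, ?_⟩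
    · rw [polyFun_C, map_mul, mul_comm, pow_one]; rfl
    · rw [MvPolynomial.eval_C, pow_one, sub_self]
      rw [coordDegree_zero]
      exact WithBot.bot_lt_coe _
  | add p q hp hq =>
    obtain ⟨N, Q, h, hd⟩ := hp
    obtain ⟨N', Q', h', hd'⟩ := hq
    refine ⟨N + N', Q * CoordinateRing.mk E Polynomial.X ^ N' +
      Q' * CoordinateRing.mk E Polynomial.X ^ N, ?_, ?_⟩
    · rw [map_add, map_mul, map_mul, h, h', map_pow, map_pow, map_add]
      change _ * yFun E ^ _ + _ * yFun E ^ _ = _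
      ring
    · have h1 := coordDegree_mul_lt hd (coordDegree_y_pow N').le
      have h2 := coordDegree_mul_lt hd' (coordDegree_y_pow N).le
      rw [← mul_add] at h1 h2
      rw [add_comm N' N] at h2
      refine lt_of_eq_of_lt (congrArg coordDegree ?_)
        ((coordDegree_add_le _ _).trans_lt (max_lt h1 h2))
      simp only [map_add]
      ring
  | mul_X p i hp =>
    obtain ⟨N, Q, h, hd⟩ := hp
    have hQ := coordDegree_le_of_sub_lt hd
    have hy := yFun_ne_zero E
    -- The new factor is x (degree 2) or 1 (degree 0), while the denominator gains y of degree 3, so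
    -- the top degree is not reached, in accordance with a zero constant term.
    have key (a : E.CoordinateRing) (ha : coordDegree a ≤ (2 : ℕ)) :
        coordDegree (Q * a - CoordinateRing.mk E (Polynomial.C (Polynomial.C
          (MvPolynomial.eval 0 (p * MvPolynomial.X i)))) *
          CoordinateRing.mk E Polynomial.X ^ (N + 1)) < (3 * (N + 1) : ℕ) := by
      simp only [map_mul, MvPolynomial.eval_X, Pi.zero_apply, mul_zero, map_zero, zero_mul,
        sub_zero]
      refine (coordDegree_mul_le hQ ha).trans_lt ?_
      exact_mod_cast (by omega : 3 * N + 2 < 3 * (N + 1))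
    fin_cases i
    · refine ⟨N + 1, _, ?_, key (CoordinateRing.mk E (Polynomial.C Polynomial.X))
        coordDegree_x.le⟩
      rw [map_mul, map_mul, h, polyFun_X]
      change _ * xFun E = _ * (_ * (xFun E / yFun E))
      field_simp
      ring
    · refine ⟨N + 1, _, ?_, key 1 (by simp [coordDegree])⟩
      rw [map_mul, map_mul, h, polyFun_X, map_one]
      change _ = _ * (_ * (1 / yFun E))
      field_simp
      ring

/-- Makes values at `P` well defined: a polynomial relation between the centred coordinates has no
constant term. At infinity a constant term would survive as the term of degree 3N; at an affine
point one evaluates. -/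
theorem eval_eq_zero_of_polyFun_eq_zero {P : E.Point} {p : MvPolynomial (Fin 2) ℂ}
    (h : polyFun P p = 0) : MvPolynomial.eval 0 p = 0 := by
  rcases P with _ | ⟨x, y, hP⟩
  · obtain ⟨N, Q, hQ, hd⟩ := exists_polyFun_zero (E := E) p
    change polyFun (0 : E.Point) p = 0 at h
    rw [h, mul_zero, IsFractionRing.to_map_eq_zero_iff] at hQ
    by_contra hp
    rw [hQ, zero_sub, ← neg_mul, ← map_neg, ← map_neg, ← map_neg, coordDegree_mul,
      coordDegree_const (neg_ne_zero.2 hp), coordDegree_y_pow, zero_add] at hd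
    exact lt_irrefl _ hd
  · rw [← algebraMap_polyCoord, IsFractionRing.to_map_eq_zero_iff] at h
    rw [← evalPoint_polyCoord hP.1, h, map_zero]

/-! ### Arithmetic of values and of powers of the point ideal -/

/-- The rational function `r` is regular at `P` with value `c`. -/
def HasValue (P : E.Point) (r : E.FunctionField) (c : ℂ) : Prop := InPow P 1 (r - constHom E c)

theorem hasValue_zero_iff {P : E.Point} {r : E.FunctionField} : HasValue P r 0 ↔ InPow P 1 r := by
  rw [HasValue, map_zero, sub_zero]

theorem InPow.mem {P : E.Point} {e : ℕ} {r : E.FunctionField} (h : InPow P e r) :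
    r ∈ localRing P := h.1

theorem InPow.add {P : E.Point} {e : ℕ} {r s : E.FunctionField} (hr : InPow P e r)
    (hs : InPow P e s) : InPow P e (r + s) :=
  ⟨add_mem hr.1 hs.1, add_mem hr.2 hs.2⟩

theorem InPow.neg {P : E.Point} {e : ℕ} {r : E.FunctionField} (hr : InPow P e r) :
    InPow P e (-r) :=
  ⟨neg_mem hr.1, neg_mem hr.2⟩

theorem InPow.sub {P : E.Point} {e : ℕ} {r s : E.FunctionField} (hr : InPow P e r)
    (hs : InPow P e s) : InPow P e (r - s) :=
  ⟨sub_mem hr.1 hs.1, sub_mem hr.2 hs.2⟩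

theorem InPow.mul {P : E.Point} {e f : ℕ} {r s : E.FunctionField} (hr : InPow P e r)
    (hs : InPow P f s) : InPow P (e + f) (r * s) :=
  ⟨mul_mem hr.1 hs.1, by rw [pow_add]; exact Ideal.mul_mem_mul hr.2 hs.2⟩

theorem inPow_zero {P : E.Point} {r : E.FunctionField} : InPow P 0 r ↔ r ∈ localRing P :=
  ⟨fun h => h.1, fun h => ⟨h, by simp⟩⟩

theorem InPow.mul_mem {P : E.Point} {e : ℕ} {r s : E.FunctionField} (hr : InPow P e r)
    (hs : s ∈ localRing P) : InPow P e (r * s) :=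
  hr.mul (inPow_zero.2 hs)

theorem InPow.mono {P : E.Point} {e f : ℕ} {r : E.FunctionField} (hr : InPow P e r) (h : f ≤ e) :
    InPow P f r :=
  ⟨hr.1, Ideal.pow_le_pow_right h hr.2⟩

theorem inPow_localCoord (P : E.Point) (i : Fin 2) : InPow P 1 (localCoord P i) :=
  ⟨localCoord_mem P i, by rw [pow_one]; exact Ideal.subset_span ⟨i, rfl⟩⟩

/-- Splits off one coordinate factor, which is how first-order expansions at `P` are obtained. -/
theorem InPow.exists_eq {P : E.Point} {e : ℕ} {r : E.FunctionField} (hr : InPow P (e + 1) r) :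
    ∃ a b : E.FunctionField, InPow P e a ∧ InPow P e b ∧
      r = a * localCoord P 0 + b * localCoord P 1 := by
  obtain ⟨h, hr⟩ := hr
  rw [pow_succ] at hr
  suffices ∀ s ∈ pointIdeal P ^ e * pointIdeal P, ∃ a b : E.FunctionField, InPow P e a ∧
      InPow P e b ∧ (s : E.FunctionField) = a * localCoord P 0 + b * localCoord P 1 from this _ hr
  intro s hs
  refine Submodule.mul_induction_on hs (fun m hm n hn => ?_) ?_
  · have : (Set.range fun i : Fin 2 => (⟨localCoord P i, localCoord_mem P i⟩ : localRing P)) =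
        {⟨localCoord P 0, localCoord_mem P 0⟩, ⟨localCoord P 1, localCoord_mem P 1⟩} := by
      ext; simp [Fin.exists_fin_two, eq_comm]
    rw [pointIdeal, this, Ideal.mem_span_pair] at hn
    obtain ⟨a, b, rfl⟩ := hn
    have hm' : InPow P e (m : E.FunctionField) := ⟨m.2, hm⟩
    refine ⟨m * a, m * b, hm'.mul_mem a.2, hm'.mul_mem b.2, ?_⟩
    push_cast
    ring
  · rintro s t ⟨a, b, ha, hb, hs⟩ ⟨a', b', ha', hb', ht⟩
    refine ⟨a + a', b + b', ha.add ha', hb.add hb', ?_⟩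
    push_cast
    rw [hs, ht]
    ring

theorem polyFun_mem (P : E.Point) (p : MvPolynomial (Fin 2) ℂ) : polyFun P p ∈ localRing P :=
  ⟨p, 1, by simp, by simp⟩

theorem constHom_mem (P : E.Point) (c : ℂ) : constHom E c ∈ localRing P := by
  rw [← polyFun_C P]; exact polyFun_mem P _

theorem hasValue_const (P : E.Point) (c : ℂ) : HasValue P (constHom E c) c := by
  rw [HasValue, sub_self]; exact ⟨zero_mem _, zero_mem _⟩

theorem HasValue.mem {P : E.Point} {r : E.FunctionField} {c : ℂ} (h : HasValue P r c) :
    r ∈ localRing P := by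
  simpa using add_mem (InPow.mem h) (constHom_mem P c)

theorem HasValue.add {P : E.Point} {r s : E.FunctionField} {c d : ℂ} (hr : HasValue P r c)
    (hs : HasValue P s d) : HasValue P (r + s) (c + d) := by
  rw [HasValue, map_add, add_sub_add_comm]
  exact InPow.add hr hs

theorem HasValue.neg {P : E.Point} {r : E.FunctionField} {c : ℂ} (hr : HasValue P r c) :
    HasValue P (-r) (-c) := by
  rw [HasValue, map_neg, ← neg_sub']
  exact InPow.neg hr

theorem HasValue.sub {P : E.Point} {r s : E.FunctionField} {c d : ℂ} (hr : HasValue P r c)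
    (hs : HasValue P s d) : HasValue P (r - s) (c - d) := by
  rw [sub_eq_add_neg, sub_eq_add_neg]
  exact hr.add hs.neg

theorem HasValue.mul {P : E.Point} {r s : E.FunctionField} {c d : ℂ} (hr : HasValue P r c)
    (hs : HasValue P s d) : HasValue P (r * s) (c * d) := by
  have : r * s - constHom E (c * d) =
      (r - constHom E c) * s + (s - constHom E d) * constHom E c := by
    rw [map_mul]; ring
  rw [HasValue, this]
  exact (InPow.mul_mem hr hs.mem).add (InPow.mul_mem hs (constHom_mem P c))

theorem HasValue.pow {P : E.Point} {r : E.FunctionField} {c : ℂ} (hr : HasValue P r c) (n : ℕ) :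
    HasValue P (r ^ n) (c ^ n) := by
  induction n with
  | zero => simpa using hasValue_const P 1
  | succ n ih => rw [pow_succ, pow_succ]; exact ih.mul hr

theorem hasValue_localCoord (P : E.Point) (i : Fin 2) : HasValue P (localCoord P i) 0 :=
  hasValue_zero_iff.2 (inPow_localCoord P i)

theorem hasValue_polyFun (P : E.Point) (p : MvPolynomial (Fin 2) ℂ) :
    HasValue P (polyFun P p) (MvPolynomial.eval 0 p) := by
  induction p using MvPolynomial.induction_on with
  | C c => rw [polyFun_C, MvPolynomial.eval_C]; exact hasValue_const P c
  | add p q hp hq => rw [map_add, map_add]; exact hp.add hq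
  | mul_X p i hp =>
    rw [map_mul, map_mul, polyFun_X, MvPolynomial.eval_X]
    exact hp.mul (hasValue_localCoord P i)

theorem polyFun_ne_zero (P : E.Point) {q : MvPolynomial (Fin 2) ℂ}
    (hq : MvPolynomial.eval 0 q ≠ 0) : polyFun P q ≠ 0 :=
  fun h => hq (eval_eq_zero_of_polyFun_eq_zero h)

theorem mem_localRing_iff {P : E.Point} {r : E.FunctionField} : r ∈ localRing P ↔
    ∃ p q : MvPolynomial (Fin 2) ℂ, MvPolynomial.eval 0 q ≠ 0 ∧ r = polyFun P p / polyFun P q := by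
  refine exists₂_congr fun p q => and_congr_right fun hq => ?_
  rw [eq_div_iff (polyFun_ne_zero P hq), mul_comm]

theorem inv_polyFun_mem (P : E.Point) {q : MvPolynomial (Fin 2) ℂ}
    (hq : MvPolynomial.eval 0 q ≠ 0) : (polyFun P q)⁻¹ ∈ localRing P :=
  mem_localRing_iff.2 ⟨1, q, hq, by rw [map_one, one_div]⟩

/-- The point ideal is proper: clearing denominators in c = a u + b v gives a polynomial relation
with constant term c q(0) q'(0). -/
theorem eq_zero_of_inPow_const {P : E.Point} {c : ℂ} (h : InPow P 1 (constHom E c)) : c = 0 := by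
  obtain ⟨a, b, ha, hb, h⟩ := InPow.exists_eq (e := 0) h
  obtain ⟨p, q, hq, rfl⟩ := mem_localRing_iff.1 ha.mem
  obtain ⟨p', q', hq', rfl⟩ := mem_localRing_iff.1 hb.mem
  have h1 : polyFun P (MvPolynomial.C c * q * q' - p * q' * MvPolynomial.X 0 -
      p' * q * MvPolynomial.X 1) = 0 := by
    have := polyFun_ne_zero P hq
    have := polyFun_ne_zero P hq'
    simp only [map_sub, map_mul, polyFun_X, polyFun_C, h]
    field_simp
    ring
  have h2 := eval_eq_zero_of_polyFun_eq_zero h1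
  simp only [map_sub, map_mul, MvPolynomial.eval_C, MvPolynomial.eval_X, Pi.zero_apply, mul_zero,
    sub_zero] at h2
  exact (mul_eq_zero.1 ((mul_eq_zero.1 h2).resolve_right hq')).resolve_right hq

theorem HasValue.unique {P : E.Point} {r : E.FunctionField} {c d : ℂ} (hc : HasValue P r c)
    (hd : HasValue P r d) : c = d := by
  have := hasValue_zero_iff.1 (sub_self d ▸ hd.sub hd)
  rw [← sub_eq_zero]
  refine eq_zero_of_inPow_const (P := P) ?_
  rw [map_sub, ← sub_sub_sub_cancel_left _ _ r]
  exact InPow.sub hd hc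

theorem HasValue.inv {P : E.Point} {r : E.FunctionField} {c : ℂ} (h : HasValue P r c)
    (hc : c ≠ 0) : HasValue P r⁻¹ c⁻¹ := by
  obtain ⟨p, q, hq, rfl⟩ := mem_localRing_iff.1 h.mem
  have hqne := polyFun_ne_zero P hq
  -- The numerator is r q, so its value is c q(0), which is nonzero.
  have hp : MvPolynomial.eval 0 p ≠ 0 := by
    have h1 := h.mul (hasValue_polyFun P q)
    rw [div_mul_cancel₀ _ hqne] at h1
    rw [(hasValue_polyFun P p).unique h1]
    exact mul_ne_zero hc hq
  have hpne := polyFun_ne_zero P hp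
  rw [inv_div]
  have : polyFun P q / polyFun P p - constHom E c⁻¹ =
      (polyFun P p / polyFun P q - constHom E c) *
        (-(polyFun P q * (polyFun P p)⁻¹ * constHom E c⁻¹)) := by
    have hc' : constHom E c ≠ 0 := by simpa using hc
    rw [map_inv₀]
    field_simp
    ring
  rw [HasValue, this]
  exact InPow.mul_mem h (neg_mem (mul_mem (mul_mem (polyFun_mem P q) (inv_polyFun_mem P hp))
    (constHom_mem P _)))

theorem HasValue.div {P : E.Point} {r s : E.FunctionField} {c d : ℂ} (hr : HasValue P r c)
    (hs : HasValue P s d) (hd : d ≠ 0) : HasValue P (r / s) (c / d) := by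
  rw [div_eq_mul_inv, div_eq_mul_inv]
  exact hr.mul (hs.inv hd)

theorem exists_hasValue {P : E.Point} {r : E.FunctionField} (h : r ∈ localRing P) :
    ∃ c, HasValue P r c := by
  obtain ⟨p, q, hq, rfl⟩ := mem_localRing_iff.1 h
  exact ⟨_, (hasValue_polyFun P p).div (hasValue_polyFun P q) hq⟩

theorem HasValue.ne_zero {P : E.Point} {r : E.FunctionField} {c : ℂ} (h : HasValue P r c)
    (hc : c ≠ 0) : r ≠ 0 := by
  rintro rfl
  exact hc (h.unique (by simpa using hasValue_const P 0))

theorem value_eq_coe_iff {P : E.Point} {r : E.FunctionField} {c : ℂ} :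
    value r P = (c : OnePoint ℂ) ↔ HasValue P r c := by
  rw [value]
  split_ifs with h
  · rw [OnePoint.coe_eq_coe]
    have h' : HasValue P r h.choose := h.choose_spec
    exact ⟨fun hc => hc ▸ h', fun hc => h'.unique hc⟩
  · simp only [OnePoint.infty_ne_coe, false_iff]
    exact fun hc => h ⟨c, hc⟩

theorem value_eq_infty_iff {P : E.Point} {r : E.FunctionField} :
    value r P = ∞ ↔ r ∉ localRing P := by
  rw [value]
  split_ifs with h
  · obtain ⟨c, hc⟩ := h
    simpa using HasValue.mem hc
  · simp only [true_iff]
    exact fun hr => h (exists_hasValue hr)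

/-! ### The invariant derivation -/

/-- The derivative `dy / ω` of `y` with respect to the invariant differential `ω`. -/
def derivY (E : WeierstrassCurve.Affine ℂ) : E.FunctionField :=
  constHom E 3 * xFun E ^ 2 + constHom E (2 * E.a₂) * xFun E + constHom E E.a₄ -
    constHom E E.a₁ * yFun E

/-- The derivative `dx / ω` of `x` with respect to the invariant differential `ω`. -/
def derivX (E : WeierstrassCurve.Affine ℂ) : E.FunctionField :=
  constHom E 2 * yFun E + constHom E E.a₁ * xFun E + constHom E E.a₃

/-- The homomorphism `r ↦ r + D r ε` to the dual numbers on the coordinate ring, where `D` is the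
invariant derivation. -/
def coordDualHom (E : WeierstrassCurve.Affine ℂ) :
    E.CoordinateRing →+* DualNumber E.FunctionField :=
  coordLift ((TrivSqZeroExt.inlHom _ _).comp (constHom E))
    (TrivSqZeroExt.inl (xFun E) + TrivSqZeroExt.inr (derivX E))
    (TrivSqZeroExt.inl (yFun E) + TrivSqZeroExt.inr (derivY E)) (by
      have h := equation_fun E
      ext
      · simpa [pow_succ] using h
      -- For the Weierstrass polynomial F, Dx = F_y and Dy = -F_x, so the ε-part F_x Dx + F_y Dy
      -- cancels.
      · simp [pow_succ, derivX, derivY, map_ofNat]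
        ring)

theorem fst_coordDualHom (a : E.CoordinateRing) :
    (coordDualHom E a).fst = algebraMap _ E.FunctionField a := by
  induction a using coordinateRing_induction with
  | const c => simp only [coordDualHom, coordLift_const]; rfl
  | x => simp only [coordDualHom, coordLift_x]; simp [xFun]
  | y => simp only [coordDualHom, coordLift_y]; simp [yFun]
  | add a b ha hb => rw [map_add, map_add, TrivSqZeroExt.fst_add, ha, hb]
  | mul a b ha hb => rw [map_mul, map_mul, TrivSqZeroExt.fst_mul, ha, hb]

/-- The homomorphism `r ↦ r + D r ε` to the dual numbers on the function field, where `D` is the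
invariant derivation. -/
def dualHom (E : WeierstrassCurve.Affine ℂ) : E.FunctionField →+* DualNumber E.FunctionField :=
  IsLocalization.lift (M := nonZeroDivisors E.CoordinateRing) (g := coordDualHom E) fun a => by
    rw [TrivSqZeroExt.isUnit_iff_isUnit_fst, fst_coordDualHom, isUnit_iff_ne_zero]
    exact IsFractionRing.to_map_ne_zero_of_mem_nonZeroDivisors a.2

theorem dualHom_algebraMap (a : E.CoordinateRing) :
    dualHom E (algebraMap _ E.FunctionField a) = coordDualHom E a :=
  IsLocalization.lift_eq _ _

theorem fst_dualHom (r : E.FunctionField) : (dualHom E r).fst = r := by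
  have : ((TrivSqZeroExt.fstHom ℂ E.FunctionField E.FunctionField : _ →+* _).comp (dualHom E)) =
      RingHom.id _ := by
    refine IsLocalization.ringHom_ext (nonZeroDivisors E.CoordinateRing) (RingHom.ext fun a => ?_)
    simp [dualHom_algebraMap, fst_coordDualHom]
  exact DFunLike.congr_fun this r

theorem dualHom_const (c : ℂ) : dualHom E (constHom E c) = TrivSqZeroExt.inl (constHom E c) := by
  rw [← constFun_eq, constFun, dualHom_algebraMap, coordDualHom, coordLift_const]
  rfl

/-- The invariant derivation of the function field, dual to the invariant differential. -/
def invDeriv (E : WeierstrassCurve.Affine ℂ) : Derivation ℂ E.FunctionField E.FunctionField :=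
  Derivation.mk'
    { toFun := fun r => (dualHom E r).snd
      map_add' := by simp
      map_smul' := fun c r => by
        have h : algebraMap ℂ E.FunctionField c = constHom E c := rfl
        rw [Algebra.smul_def, h, map_mul, dualHom_const]
        simp [Algebra.smul_def, h] } (by
    intro a b
    simp [fst_dualHom, mul_comm b])

theorem invDeriv_apply (r : E.FunctionField) : invDeriv E r = (dualHom E r).snd := rfl

theorem invDeriv_const (c : ℂ) : invDeriv E (constHom E c) = 0 := by
  rw [invDeriv_apply, dualHom_const, TrivSqZeroExt.snd_inl]

theorem invDeriv_x : invDeriv E (xFun E) = derivX E := by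
  rw [invDeriv_apply, xFun, dualHom_algebraMap, coordDualHom, coordLift_x]
  simp

theorem invDeriv_y : invDeriv E (yFun E) = derivY E := by
  rw [invDeriv_apply, yFun, dualHom_algebraMap, coordDualHom, coordLift_y]
  simp

theorem invDeriv_mul (a b : E.FunctionField) :
    invDeriv E (a * b) = a * invDeriv E b + b * invDeriv E a :=
  (invDeriv E).leibniz a b

theorem localCoord_zero_zero : localCoord (0 : E.Point) 0 = xFun E / yFun E := rfl

theorem localCoord_zero_one : localCoord (0 : E.Point) 1 = 1 / yFun E := rfl

/-- The Weierstrass equation in the coordinates at infinity. -/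
theorem equation_infinity (E : WeierstrassCurve.Affine ℂ) (z w : E.FunctionField)
    (hz : z = localCoord (0 : E.Point) 0) (hw : w = localCoord (0 : E.Point) 1) :
    w + constHom E E.a₁ * z * w + constHom E E.a₃ * w ^ 2 = z ^ 3 + constHom E E.a₂ * z ^ 2 * w +
      constHom E E.a₄ * z * w ^ 2 + constHom E E.a₆ * w ^ 3 := by
  have h := equation_fun E
  have hy := yFun_ne_zero E
  rw [hz, hw, localCoord_zero_zero, localCoord_zero_one]
  field_simp
  linear_combination h

theorem invDeriv_localCoord_zero_one (E : WeierstrassCurve.Affine ℂ) (z w : E.FunctionField)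
    (hz : z = localCoord (0 : E.Point) 0) (hw : w = localCoord (0 : E.Point) 1) :
    invDeriv E (localCoord (0 : E.Point) 1) = constHom E E.a₁ * w - constHom E 3 * z ^ 2 -
      constHom E (2 * E.a₂) * z * w - constHom E E.a₄ * w ^ 2 := by
  have hy := yFun_ne_zero E
  rw [hz, hw, localCoord_zero_one, localCoord_zero_zero, one_div, Derivation.leibniz_inv,
    invDeriv_y, derivY, smul_eq_mul]
  field_simp
  ring

theorem invDeriv_localCoord_zero_zero (E : WeierstrassCurve.Affine ℂ) (z w : E.FunctionField)
    (hz : z = localCoord (0 : E.Point) 0) (hw : w = localCoord (0 : E.Point) 1) :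
    invDeriv E (localCoord (0 : E.Point) 0) = -1 - constHom E E.a₁ * z -
      constHom E (2 * E.a₃) * w + constHom E E.a₂ * z ^ 2 + constHom E (2 * E.a₄) * z * w +
      constHom E (3 * E.a₆) * w ^ 2 := by
  have hy := yFun_ne_zero E
  have h := equation_fun E
  rw [hz, hw, localCoord_zero_one, localCoord_zero_zero, Derivation.leibniz_div,
    invDeriv_y, invDeriv_x, derivY, derivX]
  simp only [map_mul, map_ofNat, smul_eq_mul]
  field_simp
  linear_combination (3 : E.FunctionField) * h

/-- The derivatives at `P` of the coordinates centred at `P`, not both zero, determine the relation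
between the coordinates to first order. -/
theorem exists_hasValue_invDeriv_localCoord [E.IsElliptic] (P : E.Point) :
    ∃ α β : ℂ, HasValue P (invDeriv E (localCoord P 0)) α ∧
      HasValue P (invDeriv E (localCoord P 1)) β ∧ (α ≠ 0 ∨ β ≠ 0) ∧
      InPow P 2 (constHom E β * localCoord P 0 - constHom E α * localCoord P 1) := by
  have hu := hasValue_localCoord P 0
  have hv := hasValue_localCoord P 1
  have hu2 := (inPow_localCoord P 0).mul (inPow_localCoord P 0)
  have huv := (inPow_localCoord P 0).mul (inPow_localCoord P 1)
  have hv2 := (inPow_localCoord P 1).mul (inPow_localCoord P 1)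
  have hc := constHom_mem P
  rcases P with _ | ⟨x, y, hP⟩
  · change HasValue (0 : E.Point) (localCoord (0 : E.Point) 0) 0 at hu
    change HasValue (0 : E.Point) (localCoord (0 : E.Point) 1) 0 at hv
    -- With z = x/y and w = 1/y, the derivative of z is -1 plus terms vanishing at infinity and that
    -- of w vanishes there; the relation then says that w lies in M².
    refine ⟨-1, 0, ?_, ?_, by simp, ?_⟩
    · change HasValue (0 : E.Point) (invDeriv E (localCoord (0 : E.Point) 0)) _
      rw [invDeriv_localCoord_zero_zero E _ _ rfl rfl]
      have hc := hasValue_const (E := E) 0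
      have := (((((hc (-1)).sub ((hc E.a₁).mul hu)).sub ((hc (2 * E.a₃)).mul hv)).add
        ((hc E.a₂).mul (hu.pow 2))).add (((hc (2 * E.a₄)).mul hu).mul hv)).add
        ((hc (3 * E.a₆)).mul (hv.pow 2))
      simpa using this
    · change HasValue (0 : E.Point) (invDeriv E (localCoord (0 : E.Point) 1)) _
      rw [invDeriv_localCoord_zero_one E _ _ rfl rfl]
      have hc := hasValue_const (E := E) 0
      have := ((((hc E.a₁).mul hv).sub ((hc 3).mul (hu.pow 2))).sub
        (((hc (2 * E.a₂)).mul hu).mul hv)).sub ((hc E.a₄).mul (hv.pow 2))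
      simpa using this
    · change InPow (0 : E.Point) 2 _ at hu2 huv hv2
      change InPow (0 : E.Point) 2 (constHom E 0 * localCoord (0 : E.Point) 0 -
        constHom E (-1) * localCoord (0 : E.Point) 1)
      have h := equation_infinity E _ _ rfl rfl
      have : constHom E 0 * localCoord (0 : E.Point) 0 -
        constHom E (-1) * localCoord (0 : E.Point) 1 =
        localCoord (0 : E.Point) 0 * localCoord (0 : E.Point) 0 * (localCoord (0 : E.Point) 0 +
          constHom E E.a₂ * localCoord (0 : E.Point) 1) +
        localCoord (0 : E.Point) 0 * localCoord (0 : E.Point) 1 *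
          (constHom E E.a₄ * localCoord (0 : E.Point) 1 - constHom E E.a₁) +
        localCoord (0 : E.Point) 1 * localCoord (0 : E.Point) 1 *
          (constHom E E.a₆ * localCoord (0 : E.Point) 1 - constHom E E.a₃) := by
        simp only [map_zero, map_neg, map_one]
        linear_combination h
      rw [this]
      exact ((hu2.mul_mem (add_mem hu.mem (mul_mem (hc _) hv.mem))).add
        (huv.mul_mem (sub_mem (mul_mem (hc _) hv.mem) (hc _)))).add
        (hv2.mul_mem (sub_mem (mul_mem (hc _) hv.mem) (hc _)))
  · have hc' := hasValue_const (E := E) (Point.some x y hP)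
    have hx : HasValue (Point.some x y hP) (xFun E) x := by
      simpa [localCoord, constFun_eq] using hu.add (hc' x)
    have hy : HasValue (Point.some x y hP) (yFun E) y := by
      simpa [localCoord, constFun_eq] using hv.add (hc' y)
    -- These are F_y and -F_x at the point, not both zero by nonsingularity.
    refine ⟨2 * y + E.a₁ * x + E.a₃, 3 * x ^ 2 + 2 * E.a₂ * x + E.a₄ - E.a₁ * y, ?_, ?_, ?_, ?_⟩
    · have : invDeriv E (localCoord (Point.some x y hP) 0) = derivX E := by
        simp [localCoord, constFun_eq, invDeriv_x, invDeriv_const]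
      rw [this]
      exact (((hc' 2).mul hy).add ((hc' _).mul hx)).add (hc' _)
    · have : invDeriv E (localCoord (Point.some x y hP) 1) = derivY E := by
        simp [localCoord, constFun_eq, invDeriv_y, invDeriv_const]
      rw [this]
      exact ((((hc' 3).mul (hx.pow 2)).add ((hc' _).mul hx)).add (hc' _)).sub ((hc' _).mul hy)
    · rcases ((nonsingular_iff' x y).1 hP).2 with h | h
      · right
        contrapose! h
        linear_combination -h
      · exact Or.inl h
    · have h := equation_fun E
      have h0 := congrArg (constHom E) ((equation_iff x y).1 hP.1)
      simp only [map_add, map_mul, map_pow] at h0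
      -- Taylor expansion of the Weierstrass equation at (x, y): the linear part equals terms of
      -- order at least two.
      have : constHom E (3 * x ^ 2 + 2 * E.a₂ * x + E.a₄ - E.a₁ * y) *
          localCoord (Point.some x y hP) 0 - constHom E (2 * y + E.a₁ * x + E.a₃) *
          localCoord (Point.some x y hP) 1 =
        localCoord (Point.some x y hP) 1 * localCoord (Point.some x y hP) 1 +
        localCoord (Point.some x y hP) 0 * localCoord (Point.some x y hP) 1 * constHom E E.a₁ -
        localCoord (Point.some x y hP) 0 * localCoord (Point.some x y hP) 0 *
          (constHom E (3 * x + E.a₂) + localCoord (Point.some x y hP) 0) := by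
        simp only [localCoord, constFun_eq, Matrix.cons_val_zero, Matrix.cons_val_one, map_add,
          map_sub, map_mul, map_pow, map_ofNat]
        linear_combination h0 - h
      rw [this]
      exact (hv2.add (huv.mul_mem (hc _))).sub (hu2.mul_mem (add_mem (hc _) hu.mem))

theorem invDeriv_mem [E.IsElliptic] {P : E.Point} {r : E.FunctionField} (hr : r ∈ localRing P) :
    invDeriv E r ∈ localRing P := by
  have hp (p : MvPolynomial (Fin 2) ℂ) : invDeriv E (polyFun P p) ∈ localRing P := by
    induction p using MvPolynomial.induction_on with
    | C c => rw [polyFun_C, invDeriv_const]; exact zero_mem _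
    | add p q hp hq => rw [map_add, map_add]; exact add_mem hp hq
    | mul_X p i hp =>
      obtain ⟨α, β, hα, hβ, -⟩ := exists_hasValue_invDeriv_localCoord P
      have hi : invDeriv E (localCoord P i) ∈ localRing P := by
        fin_cases i
        exacts [hα.mem, hβ.mem]
      rw [map_mul, invDeriv_mul, polyFun_X]
      exact add_mem (mul_mem (polyFun_mem P p) hi) (mul_mem (localCoord_mem P i) hp)
  obtain ⟨p, q, hq, rfl⟩ := mem_localRing_iff.1 hr
  have hq' := inv_polyFun_mem P hq
  rw [Derivation.leibniz_div]
  exact mul_mem (pow_mem hq' 2)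
    (sub_mem (mul_mem (polyFun_mem P q) (hp p)) (mul_mem (polyFun_mem P p) (hp q)))

theorem InPow.invDeriv [E.IsElliptic] {P : E.Point} {r : E.FunctionField} (hr : InPow P 2 r) :
    InPow P 1 (invDeriv E r) := by
  obtain ⟨a, b, ha, hb, rfl⟩ := hr.exists_eq (e := 1)
  have h (i : Fin 2) {a : E.FunctionField} (ha : InPow P 1 a) :
      InPow P 1 (ToroidalBelyi.invDeriv E (a * localCoord P i)) := by
    rw [invDeriv_mul]
    exact (ha.mul_mem (invDeriv_mem (localCoord_mem P i))).add
      ((inPow_localCoord P i).mul_mem (invDeriv_mem ha.mem))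
  rw [map_add]
  exact (h 0 ha).add (h 1 hb)

/-- A function vanishing at `P` vanishes to order two if its derivative vanishes at `P`. -/
theorem inPow_two_of_invDeriv [E.IsElliptic] {P : E.Point} {r : E.FunctionField}
    (hr : InPow P 1 r) (hd : InPow P 1 (invDeriv E r)) : InPow P 2 r := by
  obtain ⟨α, β, hα, hβ, h0, h2⟩ := exists_hasValue_invDeriv_localCoord P
  obtain ⟨a, b, ha, hb, rfl⟩ := hr.exists_eq (e := 0)
  obtain ⟨a₀, ha₀⟩ := exists_hasValue ha.mem
  obtain ⟨b₀, hb₀⟩ := exists_hasValue hb.mem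
  obtain ⟨a₁, ha₁⟩ := exists_hasValue (invDeriv_mem ha.mem)
  obtain ⟨b₁, hb₁⟩ := exists_hasValue (invDeriv_mem hb.mem)
  have hu := hasValue_localCoord P 0
  have hv := hasValue_localCoord P 1
  have hval : a₀ * α + b₀ * β = 0 := by
    have := ((ha₀.mul hα).add (hu.mul ha₁)).add ((hb₀.mul hβ).add (hv.mul hb₁))
    rw [← invDeriv_mul, ← invDeriv_mul, ← map_add] at this
    simpa using this.unique (hasValue_zero_iff.2 hd)
  -- To first order r is a₀u + b₀v. Since (a₀, b₀) annihilates (α, β) ≠ 0, it is a multiple of (β,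
  -- -α), and βu - αv is already in M².
  obtain ⟨c, hca, hcb⟩ : ∃ c, a₀ = c * β ∧ b₀ = -(c * α) := by
    by_cases hα0 : α = 0
    · have hβ0 : β ≠ 0 := h0.resolve_left (not_not.2 hα0)
      refine ⟨a₀ / β, by field_simp, ?_⟩
      rw [hα0, mul_zero, zero_add] at hval
      rw [hα0, mul_zero, neg_zero]
      exact (mul_eq_zero.1 hval).resolve_right hβ0
    · refine ⟨-b₀ / α, ?_, by field_simp⟩
      field_simp
      linear_combination hval
  have : a * localCoord P 0 + b * localCoord P 1 = (a - constHom E a₀) * localCoord P 0 +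
      (b - constHom E b₀) * localCoord P 1 +
      (constHom E β * localCoord P 0 - constHom E α * localCoord P 1) * constHom E c := by
    simp only [hca, hcb, map_mul, map_neg]
    ring
  rw [this]
  exact ((InPow.mul (e := 1) (f := 1) ha₀ (inPow_localCoord P 0)).add
    (InPow.mul (e := 1) (f := 1) hb₀ (inPow_localCoord P 1))).add (h2.mul_mem (constHom_mem P c))

/-- Supplies a uniformizer at `P`, namely one of the two coordinates. -/
theorem exists_invDeriv_ne_zero [E.IsElliptic] (P : E.Point) :
    ∃ (t : E.FunctionField) (c : ℂ), InPow P 1 t ∧ HasValue P (invDeriv E t) c ∧ c ≠ 0 := by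
  obtain ⟨α, β, hα, hβ, h0, -⟩ := exists_hasValue_invDeriv_localCoord P
  rcases h0 with h0 | h0
  exacts [⟨_, α, inPow_localCoord P 0, hα, h0⟩, ⟨_, β, inPow_localCoord P 1, hβ, h0⟩]

/-! ### The local rings are discrete valuation rings -/

theorem isUnit_of_hasValue {P : E.Point} {r : localRing P} {c : ℂ}
    (h : HasValue P (r : E.FunctionField) c) (hc : c ≠ 0) : IsUnit r := by
  refine IsUnit.of_mul_eq_one ⟨(r : E.FunctionField)⁻¹, (h.inv hc).mem⟩ (Subtype.ext ?_)
  exact mul_inv_cancel₀ (h.ne_zero hc)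

theorem not_isUnit_of_hasValue_zero {P : E.Point} {r : localRing P}
    (h : HasValue P (r : E.FunctionField) 0) : ¬ IsUnit r := by
  intro hr
  obtain ⟨s, hs⟩ := hr.exists_right_inv
  obtain ⟨d, hd⟩ := exists_hasValue s.2
  have h1 := h.mul hd
  have h2 : (r : E.FunctionField) * s = constHom E 1 := by
    rw [map_one]; exact congrArg Subtype.val hs
  rw [h2, zero_mul] at h1
  exact one_ne_zero ((hasValue_const P 1).unique h1)

instance (P : E.Point) : IsLocalRing (localRing P) := by
  refine IsLocalRing.of_isUnit_or_isUnit_one_sub_self fun r => ?_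
  obtain ⟨c, hc⟩ := exists_hasValue r.2
  by_cases h : c = 0
  · right
    refine isUnit_of_hasValue (c := 1 - c) ?_ (by simp [h])
    simpa using (hasValue_const P 1).sub hc
  · exact Or.inl (isUnit_of_hasValue hc h)

theorem mem_maximalIdeal_iff {P : E.Point} {r : localRing P} :
    r ∈ IsLocalRing.maximalIdeal (localRing P) ↔ InPow P 1 (r : E.FunctionField) := by
  rw [IsLocalRing.mem_maximalIdeal, mem_nonunits_iff, ← hasValue_zero_iff]
  refine ⟨fun h => ?_, not_isUnit_of_hasValue_zero⟩
  obtain ⟨c, hc⟩ := exists_hasValue r.2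
  by_cases h0 : c = 0
  · rwa [h0] at hc
  · exact absurd (isUnit_of_hasValue hc h0) h

theorem maximalIdeal_eq_pointIdeal (P : E.Point) :
    IsLocalRing.maximalIdeal (localRing P) = pointIdeal P := by
  ext r
  rw [mem_maximalIdeal_iff, InPow, pow_one]
  exact ⟨fun h => h.2, fun h => ⟨r.2, h⟩⟩

/-- Denominators are units, so every ideal is extended from the polynomial ring in two variables,
which is Noetherian. -/
instance (P : E.Point) : IsNoetherianRing (localRing P) := by
  rw [isNoetherianRing_iff_ideal_fg]
  intro I
  let g : MvPolynomial (Fin 2) ℂ →+* localRing P := (polyFun P).codRestrict _ (polyFun_mem P)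
  have : I = (I.comap g).map g := by
    refine le_antisymm (fun r hr => ?_) Ideal.map_comap_le
    obtain ⟨p, q, hq, h⟩ := mem_localRing_iff.1 r.2
    have hq0 := polyFun_ne_zero P hq
    have hp : r = g p * ⟨_, inv_polyFun_mem P hq⟩ := Subtype.ext (by
      rw [h, div_eq_mul_inv]; rfl)
    have hp' : g p = r * g q := Subtype.ext (by
      change polyFun P p = (r : E.FunctionField) * polyFun P q
      rw [h, div_mul_cancel₀ _ hq0])
    rw [hp]
    refine Ideal.mul_mem_right _ _ (Ideal.mem_map_of_mem g ?_)
    rw [Ideal.mem_comap, hp']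
    exact Ideal.mul_mem_right _ _ hr
  rw [this]
  exact Ideal.FG.map (IsNoetherian.noetherian _) g

/-- Nakayama: for f in the maximal ideal m, subtracting from f the multiple of t by the ratio of the
derivatives at `P` leaves zero derivative, so m ⊆ (t) + m². -/
theorem maximalIdeal_eq_span [E.IsElliptic] {P : E.Point} {t : localRing P} {c : ℂ}
    (ht : InPow P 1 (t : E.FunctionField))
    (hd : HasValue P (invDeriv E (t : E.FunctionField)) c) (hc : c ≠ 0) :
    IsLocalRing.maximalIdeal (localRing P) = Ideal.span {t} := by
  refine le_antisymm ?_ ?_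
  · refine Submodule.le_of_le_smul_of_le_jacobson_bot (I := IsLocalRing.maximalIdeal (localRing P))
      (IsNoetherian.noetherian _) (IsLocalRing.maximalIdeal_le_jacobson _) fun f hf => ?_
    have hf' := mem_maximalIdeal_iff.1 hf
    obtain ⟨d, hfd⟩ := exists_hasValue (invDeriv_mem hf'.mem)
    have hcd := constHom_mem P (d / c)
    have h1 : InPow P 2 ((f : E.FunctionField) - t * constHom E (d / c)) := by
      refine inPow_two_of_invDeriv (hf'.sub (ht.mul_mem hcd)) ?_
      rw [map_sub, invDeriv_mul, invDeriv_const, mul_zero, zero_add, ← hasValue_zero_iff]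
      have := hfd.sub ((hasValue_const P (d / c)).mul hd)
      rwa [div_mul_cancel₀ _ hc, sub_self] at this
    have h2 : f = t * ⟨_, hcd⟩ + (f - t * ⟨_, hcd⟩) := by ring
    rw [h2]
    refine Submodule.add_mem_sup (Ideal.mul_mem_right _ _ (Ideal.mem_span_singleton_self t)) ?_
    have h3 : f - t * ⟨_, hcd⟩ ∈ IsLocalRing.maximalIdeal (localRing P) ^ 2 := by
      rw [maximalIdeal_eq_pointIdeal]
      exact h1.2
    rwa [pow_two] at h3
  · rw [Ideal.span_le, Set.singleton_subset_iff]
    exact mem_maximalIdeal_iff.2 ht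

instance [E.IsElliptic] (P : E.Point) : IsDiscreteValuationRing (localRing P) := by
  obtain ⟨t, c, ht, hd, hc⟩ := exists_invDeriv_ne_zero P
  have hspan := maximalIdeal_eq_span (t := ⟨t, ht.mem⟩) ht hd hc
  have hprin : (IsLocalRing.maximalIdeal (localRing P)).IsPrincipal := ⟨⟨_, hspan⟩⟩
  have : IsPrincipalIdealRing (localRing P) :=
    ((tfae_of_isNoetherianRing_of_isLocalRing_of_isDomain (localRing P)).out 4 0).1 hprin
  refine { not_a_field' := fun h => ?_ }
  have h0 : (⟨t, ht.mem⟩ : localRing P) = 0 := by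
    rw [← Ideal.mem_bot, ← h]
    exact mem_maximalIdeal_iff.2 ht
  have h1 : t = 0 := congrArg Subtype.val h0
  rw [h1, map_zero] at hd
  exact hd.ne_zero hc rfl

/-- A function vanishing at some point and with zero derivative vanishes. -/
theorem eq_zero_of_invDeriv_eq_zero [E.IsElliptic] {P : E.Point} {f : E.FunctionField}
    (hf : InPow P 1 f) (hd : invDeriv E f = 0) : f = 0 := by
  obtain ⟨t, c, ht, htd, hc⟩ := exists_invDeriv_ne_zero P
  have hspan := maximalIdeal_eq_span (t := ⟨t, ht.mem⟩) ht htd hc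
  have hirr : Irreducible (⟨t, ht.mem⟩ : localRing P) :=
    (IsDiscreteValuationRing.irreducible_iff_uniformizer _).2 hspan
  by_contra hf0
  have hf0' : (⟨f, hf.mem⟩ : localRing P) ≠ 0 := fun h => hf0 (congrArg Subtype.val h)
  obtain ⟨n, u, hu⟩ := IsDiscreteValuationRing.eq_unit_mul_pow_irreducible hf0' hirr
  have hfu : f = (u : localRing P) * t ^ n := congrArg Subtype.val hu
  obtain ⟨u₀, hu₀⟩ := exists_hasValue (u : localRing P).2
  have hu₀' : u₀ ≠ 0 := by
    rintro rfl
    exact not_isUnit_of_hasValue_zero hu₀ u.isUnit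
  have ht0 : t ≠ 0 := fun h => hirr.ne_zero (Subtype.ext h)
  obtain ⟨u₁, hu₁⟩ := exists_hasValue (invDeriv_mem (u : localRing P).2)
  rcases n with _ | n
  · rw [pow_zero, mul_one] at hfu
    rw [← hfu] at hu₀
    exact hu₀' (hu₀.unique (hasValue_zero_iff.2 hf))
  · rw [hfu, invDeriv_mul, Derivation.leibniz_pow] at hd
    -- Here f = u t^(n+1), and t^n is cancelled from Df = 0. The remaining factor has value (n+1)
    -- u(P) c at `P`, nonzero in characteristic zero.
    have h : constHom E ((n + 1 : ℕ) : ℂ) * (u : localRing P) * invDeriv E t +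
        t * invDeriv E ((u : localRing P) : E.FunctionField) = 0 := by
      refine (mul_eq_zero.1 (?_ : t ^ n * _ = 0)).resolve_left (pow_ne_zero n ht0)
      rw [← hd]
      simp only [map_natCast, nsmul_eq_mul, smul_eq_mul, Nat.add_sub_cancel]
      ring
    have hval := (((hasValue_const P ((n + 1 : ℕ) : ℂ)).mul hu₀).mul htd).add
      ((hasValue_zero_iff.2 ht).mul hu₁)
    rw [h, zero_mul, add_zero] at hval
    exact hval.ne_zero (mul_ne_zero (mul_ne_zero (Nat.cast_ne_zero.2 n.succ_ne_zero) hu₀') hc) rfl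

/-- The function field is the fraction field of each local ring, including the one at infinity,
where x and y are quotients of x/y and 1 by 1/y. -/
theorem exists_mul_eq (P : E.Point) (r : E.FunctionField) :
    ∃ a b : localRing P, b ≠ 0 ∧ r * b = a := by
  induction r using functionField_induction with
  | const c => exact ⟨⟨_, constHom_mem P c⟩, 1, one_ne_zero, mul_one _⟩
  | x =>
    rcases P with _ | ⟨x, y, hP⟩
    · refine ⟨⟨_, localCoord_mem 0 0⟩, ⟨_, localCoord_mem 0 1⟩, fun h => ?_, ?_⟩
      · exact one_div_ne_zero (yFun_ne_zero E) (congrArg Subtype.val h)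
      · exact mul_one_div _ _
    · refine ⟨⟨_, add_mem (localCoord_mem (Point.some x y hP) 0) (constHom_mem _ x)⟩, 1,
        one_ne_zero, ?_⟩
      simp [localCoord, constFun_eq]
  | y =>
    rcases P with _ | ⟨x, y, hP⟩
    · refine ⟨1, ⟨_, localCoord_mem 0 1⟩, fun h => ?_, ?_⟩
      · exact one_div_ne_zero (yFun_ne_zero E) (congrArg Subtype.val h)
      · exact mul_one_div_cancel (yFun_ne_zero E)
    · refine ⟨⟨_, add_mem (localCoord_mem (Point.some x y hP) 1) (constHom_mem _ y)⟩, 1,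
        one_ne_zero, ?_⟩
      simp [localCoord, constFun_eq]
  | add r s hr hs =>
    obtain ⟨a, b, hb, h⟩ := hr
    obtain ⟨a', b', hb', h'⟩ := hs
    refine ⟨a * b' + a' * b, b * b', mul_ne_zero hb hb', ?_⟩
    push_cast
    rw [← h, ← h']
    ring
  | mul r s hr hs =>
    obtain ⟨a, b, hb, h⟩ := hr
    obtain ⟨a', b', hb', h'⟩ := hs
    refine ⟨a * a', b * b', mul_ne_zero hb hb', ?_⟩
    push_cast
    rw [← h, ← h']
    ring
  | inv r hr =>
    by_cases h0 : r = 0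
    · exact ⟨0, 1, one_ne_zero, by simp [h0]⟩
    · obtain ⟨a, b, hb, h⟩ := hr
      refine ⟨b, a, ?_, ?_⟩
      · rintro rfl
        exact hb (Subtype.ext ((mul_eq_zero.1 h).resolve_left h0))
      · rw [← h, inv_mul_cancel_left₀ h0]

/-- In a valuation ring r or 1/r is regular; if r is not, then 1/r is a nonunit and so vanishes at
`P`. -/
theorem inPow_inv_of_notMem [E.IsElliptic] {P : E.Point} {r : E.FunctionField}
    (hr : r ∉ localRing P) : InPow P 1 r⁻¹ := by
  obtain ⟨a, b, hb, h⟩ := exists_mul_eq P r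
  have hb' : (b : E.FunctionField) ≠ 0 := fun h => hb (Subtype.ext h)
  obtain ⟨c, hc | hc⟩ := ValuationRing.cond a b
  · have h1 : r * c = 1 := by
      have h2 : r * b * c = b := by rw [h]; exact congrArg Subtype.val hc
      exact mul_right_cancel₀ hb' (by linear_combination h2)
    rw [inv_eq_of_mul_eq_one_right h1, ← mem_maximalIdeal_iff, IsLocalRing.mem_maximalIdeal,
      mem_nonunits_iff]
    intro hu
    obtain ⟨d, hd⟩ := hu.exists_right_inv
    have h2 : (c : E.FunctionField) * d = 1 := congrArg Subtype.val hd
    have h3 : r = d := by linear_combination (d : E.FunctionField) * h1 - r * h2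
    exact hr (h3 ▸ d.2)
  · refine absurd ?_ hr
    have h2 : r = c := mul_right_cancel₀ hb' (by
      rw [h, mul_comm]; exact congrArg Subtype.val hc.symm)
    exact h2 ▸ c.2

/-! ### Zeros and poles of functions -/

theorem hasValue_algebraMap {x y : ℂ} (h : E.Nonsingular x y) (a : E.CoordinateRing) :
    HasValue (Point.some x y h) (algebraMap _ E.FunctionField a) (evalPoint h.1 a) := by
  have hc := hasValue_const (Point.some x y h)
  induction a using coordinateRing_induction with
  | const c => rw [evalPoint, coordLift_const]; exact hc c
  | x =>
    rw [evalPoint, coordLift_x]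
    simpa [localCoord, constFun_eq] using! (hasValue_localCoord (Point.some x y h) 0).add (hc x)
  | y =>
    rw [evalPoint, coordLift_y]
    simpa [localCoord, constFun_eq] using! (hasValue_localCoord (Point.some x y h) 1).add (hc y)
  | add a b ha hb => rw [map_add, map_add]; exact ha.add hb
  | mul a b ha hb => rw [map_mul, map_mul]; exact ha.mul hb

theorem evalPoint_algebraMap {x y : ℂ} (h : E.Equation x y) (f : Polynomial ℂ) :
    evalPoint h (algebraMap _ E.CoordinateRing f) = f.eval x := by
  change evalPoint h (CoordinateRing.mk E (Polynomial.C f)) = _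
  have : (evalPoint h).comp ((CoordinateRing.mk E).comp Polynomial.C) =
      Polynomial.evalRingHom x := by
    refine Polynomial.ringHom_ext (fun c => ?_) ?_
    · simp [evalPoint, -AdjoinRoot.mk_C, -AdjoinRoot.mk_X]
    · simp [evalPoint, -AdjoinRoot.mk_C, -AdjoinRoot.mk_X]
  exact DFunLike.congr_fun this f

/-- The cofactor is the conjugate of a. Hence a zero of a has its x-coordinate among the roots of
the norm. -/
theorem dvd_norm (a : E.CoordinateRing) :
    a ∣ algebraMap _ E.CoordinateRing (Algebra.norm (Polynomial ℂ) a) := by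
  obtain ⟨p, q, rfl⟩ := CoordinateRing.exists_smul_basis_eq a
  have := CoordinateRing.coe_norm_smul_basis (W' := E) p q
  rw [map_mul] at this
  refine ⟨_, Eq.trans this (congrArg (· * _) ?_)⟩
  rw [CoordinateRing.smul, CoordinateRing.smul, mul_one, map_add, map_mul]

theorem finite_setOf_x (x : ℂ) : {P : E.Point | ∃ y h, P = Point.some x y h}.Finite := by
  rcases Set.eq_empty_or_nonempty {P : E.Point | ∃ y h, P = Point.some x y h} with h | h
  · rw [h]; exact Set.finite_empty
  · obtain ⟨_, y, h, rfl⟩ := h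
    refine (Set.toFinite {Point.some x y h, -Point.some x y h}).subset ?_
    rintro _ ⟨y', h', rfl⟩
    rcases Y_eq_of_X_eq h'.1 h.1 rfl with rfl | rfl
    · exact Or.inl rfl
    · exact Or.inr (by simp)

/-- A rational function with infinitely many zeros vanishes. -/
theorem eq_zero_of_infinite {r : E.FunctionField} (hr : {P : E.Point | InPow P 1 r}.Infinite) :
    r = 0 := by
  obtain ⟨a, b, -, rfl⟩ := IsFractionRing.div_surjective (A := E.CoordinateRing) r
  by_cases hb : algebraMap E.CoordinateRing E.FunctionField b = 0
  · rw [hb, div_zero]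
  suffices a = 0 by rw [this, map_zero, zero_div]
  by_contra ha
  have hN : Algebra.norm (Polynomial ℂ) a ≠ 0 := by
    refine fun h => ha ?_
    obtain ⟨p, q, rfl⟩ := CoordinateRing.exists_smul_basis_eq a
    have h1 := coordDegree_smul_basis (E := E) p q
    rw [coordDegree, h, Polynomial.degree_zero, eq_comm, max_eq_bot] at h1
    have hp : p = 0 := Polynomial.degree_eq_bot.1 (by simpa [-nsmul_eq_mul, two_nsmul] using h1.1)
    have hq : q = 0 := Polynomial.degree_eq_bot.1 (by simpa [-nsmul_eq_mul, two_nsmul] using h1.2)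
    rw [hp, hq, zero_smul, zero_smul, add_zero]
  -- The affine zeros lie over the finitely many roots of the norm of the numerator, with at most
  -- two points over each.
  refine hr (((Set.finite_singleton (0 : E.Point)).union
    ((Algebra.norm (Polynomial ℂ) a).roots.toFinset.finite_toSet.biUnion
      fun x _ => finite_setOf_x x)).subset ?_)
  rintro (_ | ⟨x, y, h⟩) hP
  · exact Or.inl rfl
  · refine Or.inr (Set.mem_biUnion (x := x) ?_ ⟨y, h, rfl⟩)
    rw [Finset.mem_coe, Multiset.mem_toFinset, Polynomial.mem_roots hN, Polynomial.IsRoot,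
      ← evalPoint_algebraMap h.1]
    have h1 := (hasValue_zero_iff.2 hP).mul (hasValue_algebraMap h b)
    rw [div_mul_cancel₀ _ hb, zero_mul] at h1
    obtain ⟨d, hd⟩ := dvd_norm a
    rw [hd, map_mul, (hasValue_algebraMap h a).unique h1, zero_mul]

instance [E.IsElliptic] : Infinite E.Point := by
  have h (x : ℂ) : ∃ y, E.Nonsingular x y := by
    obtain ⟨y, hy⟩ := IsAlgClosed.exists_root
      (Polynomial.C 1 * Polynomial.X ^ 2 + Polynomial.C (E.a₁ * x + E.a₃) * Polynomial.X +
        Polynomial.C (-(x ^ 3 + E.a₂ * x ^ 2 + E.a₄ * x + E.a₆))) (by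
        rw [Polynomial.degree_quadratic one_ne_zero]; exact two_ne_zero)
    refine ⟨y, equation_iff_nonsingular.1 ((equation_iff x y).2 ?_)⟩
    simp only [Polynomial.IsRoot, Polynomial.eval_add, Polynomial.eval_mul,
      Polynomial.eval_pow, Polynomial.eval_X, Polynomial.eval_C] at hy
    linear_combination hy
  choose y hy using h
  refine Infinite.of_injective (fun x => Point.some x (y x) (hy x)) fun x x' h => ?_
  simp only [Point.some.injEq] at h
  exact h.1

/-! ### Functions without poles -/

/-- Every maximal ideal of the coordinate ring is the ideal of a point. -/
theorem exists_evalPoint [E.IsElliptic] (m : Ideal E.CoordinateRing) [m.IsMaximal] :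
    ∃ (x y : ℂ) (h : E.Nonsingular x y), ∀ a ∈ m, evalPoint h.1 a = 0 := by
  let : Field (E.CoordinateRing ⧸ m) := Ideal.Quotient.field m
  have : Algebra.FiniteType ℂ E.CoordinateRing := AdjoinRoot.finiteType _
  have : Algebra.FiniteType ℂ (E.CoordinateRing ⧸ m) := inferInstance
  -- Nullstellensatz: the residue field is finite over ℂ, hence equal to ℂ, and the images of x and
  -- y are the coordinates of the point.
  have : Module.Finite ℂ (E.CoordinateRing ⧸ m) := finite_of_finite_type_of_isJacobsonRing _ _
  have hbij : Function.Bijective (algebraMap ℂ (E.CoordinateRing ⧸ m)) :=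
    IsAlgClosed.algebraMap_bijective_of_isIntegral
  let g : E.CoordinateRing →+* ℂ :=
    ((RingEquiv.ofBijective _ hbij).symm : _ →+* ℂ).comp (Ideal.Quotient.mk m)
  have hg (c : ℂ) : g (CoordinateRing.mk E (Polynomial.C (Polynomial.C c))) = c :=
    (RingEquiv.ofBijective _ hbij).symm_apply_apply c
  have heq : E.Equation (g (CoordinateRing.mk E (Polynomial.C Polynomial.X)))
      (g (CoordinateRing.mk E Polynomial.X)) := by
    rw [equation_iff']
    have h : CoordinateRing.mk E E.polynomial = 0 := AdjoinRoot.mk_self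
    replace h := congrArg g h
    simp only [polynomial, map_sub, map_add, map_mul, map_pow, map_zero, hg] at h
    linear_combination h
  refine ⟨_, _, equation_iff_nonsingular.1 heq, fun a ha => ?_⟩
  have (a : E.CoordinateRing) : evalPoint heq a = g a := by
    induction a using coordinateRing_induction with
    | const c => rw [hg, evalPoint, coordLift_const]; rfl
    | x => rw [evalPoint, coordLift_x]
    | y => rw [evalPoint, coordLift_y]
    | add a b ha hb => rw [map_add, map_add, ha, hb]
    | mul a b ha hb => rw [map_mul, map_mul, ha, hb]
  rw [this]
  change (RingEquiv.ofBijective _ hbij).symm (Ideal.Quotient.mk m a) = 0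
  rw [Ideal.Quotient.eq_zero_iff_mem.2 ha, map_zero]

/-- A function which is regular at all points belongs to the coordinate ring. -/
theorem exists_algebraMap_eq [E.IsElliptic] {r : E.FunctionField}
    (hr : ∀ P : E.Point, r ∈ localRing P) : ∃ a : E.CoordinateRing, algebraMap _ _ a = r := by
  -- The ideal of denominators of r. If proper, it would lie in the ideal of some point, where
  -- regularity provides a denominator that does not vanish.
  let I : Ideal E.CoordinateRing :=
    { carrier := {d | ∃ a : E.CoordinateRing, algebraMap _ _ a = algebraMap _ _ d * r}
      zero_mem' := ⟨0, by simp⟩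
      add_mem' := by
        rintro d d' ⟨a, ha⟩ ⟨a', ha'⟩
        exact ⟨a + a', by rw [map_add, map_add, ha, ha', add_mul]⟩
      smul_mem' := by
        rintro e d ⟨a, ha⟩
        exact ⟨e * a, by rw [smul_eq_mul, map_mul, map_mul, ha, mul_assoc]⟩ }
  by_cases hI : I = ⊤
  · obtain ⟨a, ha⟩ : (1 : E.CoordinateRing) ∈ I := hI ▸ Submodule.mem_top
    exact ⟨a, by rw [ha, map_one, one_mul]⟩
  · obtain ⟨m, hm, hIm⟩ := Ideal.exists_le_maximal I hI
    obtain ⟨x, y, h, hxy⟩ := exists_evalPoint m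
    obtain ⟨p, q, hq, hpq⟩ := hr (Point.some x y h)
    refine absurd ?_ hq
    rw [← evalPoint_polyCoord h.1]
    refine hxy _ (hIm ⟨polyCoord E x y p, ?_⟩)
    rw [algebraMap_polyCoord h, algebraMap_polyCoord h, hpq]

/-- A function which is regular at all points is constant. -/
theorem exists_eq_const_of_regular [E.IsElliptic] {r : E.FunctionField}
    (hr : ∀ P : E.Point, r ∈ localRing P) : ∃ c, r = constHom E c := by
  obtain ⟨a, rfl⟩ := exists_algebraMap_eq hr
  obtain ⟨p, q, hq, h⟩ := hr 0
  obtain ⟨N, Q, hQ, hd⟩ := exists_polyFun_zero (E := E) q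
  obtain ⟨N', Q', hQ', hd'⟩ := exists_polyFun_zero (E := E) p
  have h1 : CoordinateRing.mk E Polynomial.X ^ N' * Q * a =
      CoordinateRing.mk E Polynomial.X ^ N * Q' := by
    refine IsFractionRing.injective E.CoordinateRing E.FunctionField ?_
    rw [map_mul, map_mul, map_mul, hQ, hQ', ← h, map_pow, map_pow]
    change yFun E ^ _ * _ * _ = yFun E ^ _ * _
    ring
  have h2 := coordDegree_le_of_sub_lt hd
  have h3 := coordDegree_le_of_sub_lt hd'
  -- Since q(0) ≠ 0, the degree of Q is exactly 3N; comparing degrees in `h1` then bounds the degree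
  -- of a by 0.
  have h4 : ((3 * N : ℕ) : WithBot ℕ) ≤ coordDegree Q := by
    by_contra! h5
    have h6 := coordDegree_add_le (-1 * (Q - CoordinateRing.mk E (Polynomial.C (Polynomial.C
      (MvPolynomial.eval 0 q))) * CoordinateRing.mk E Polynomial.X ^ N)) Q
    have h7 : coordDegree (-1 : E.CoordinateRing) = 0 := by
      simpa using coordDegree_const (E := E) (neg_ne_zero.2 one_ne_zero)
    rw [coordDegree_mul, h7, zero_add] at h6
    have h8 : -1 * (Q - CoordinateRing.mk E (Polynomial.C (Polynomial.C (MvPolynomial.eval 0 q))) *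
        CoordinateRing.mk E Polynomial.X ^ N) + Q = CoordinateRing.mk E (Polynomial.C (Polynomial.C
      (MvPolynomial.eval 0 q))) * CoordinateRing.mk E Polynomial.X ^ N := by ring
    rw [h8, coordDegree_mul, coordDegree_const hq, coordDegree_y_pow, zero_add] at h6
    exact h6.not_gt (max_lt hd h5)
  have h5 : coordDegree a ≤ 0 := by
    have h6 := congrArg coordDegree h1
    rw [coordDegree_mul, coordDegree_mul, coordDegree_mul, coordDegree_y_pow, coordDegree_y_pow,
      le_antisymm h2 h4] at h6
    generalize coordDegree a = d at *
    have h7 := h6.le.trans (add_le_add_right h3 _)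
    induction d with
    | bot => exact bot_le
    | coe d =>
      have : 3 * N' + 3 * N + d ≤ 3 * N + 3 * N' := WithBot.coe_le_coe.1 h7
      exact WithBot.coe_le_coe.2 (by omega : d ≤ 0)
  obtain ⟨f, g, rfl⟩ := CoordinateRing.exists_smul_basis_eq a
  rw [coordDegree_smul_basis, max_le_iff] at h5
  have hg : g = 0 := by
    by_contra hg
    rw [Polynomial.degree_eq_natDegree hg] at h5
    have := h5.2
    norm_cast at this
  have hf : f.degree ≤ 0 := by
    by_cases hf : f = 0
    · simp [hf]
    · rw [Polynomial.degree_eq_natDegree hf] at h5 ⊢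
      have := h5.1
      rw [two_nsmul] at this
      norm_cast at this ⊢
      omega
  rw [hg, zero_smul, add_zero, Polynomial.eq_C_of_degree_le_zero hf, CoordinateRing.smul, mul_one]
  exact ⟨_, rfl⟩

/-! ### Pullback of functions along an isogeny -/

/-- Dividing by a coordinate of value 1 removes the local factor g, leaving functions that do not
depend on `P`. -/
theorem hasValue_div_of_homCoord {f : Fin 3 → E.FunctionField}
    {P : E.Point} {g : E.FunctionField} {Q : X.Point}
    (hg : ∀ i, HasValue P (g * f i) (homCoord Q i)) {j : Fin 3} (hj : homCoord Q j = 1)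
    (i : Fin 3) : f j ≠ 0 ∧ HasValue P (f i / f j) (homCoord Q i) := by
  have h1 := hg j
  rw [hj] at h1
  have h2 := h1.ne_zero one_ne_zero
  refine ⟨right_ne_zero_of_mul h2, ?_⟩
  have h3 := (hg i).div h1 one_ne_zero
  rwa [mul_div_mul_left _ _ (left_ne_zero_of_mul h2), div_one] at h3

/-- The field homomorphism `Φ` is the pullback of functions along the map `ψ` of curves. -/
structure IsPullback (ψ : E.Point → X.Point) (Φ : X.FunctionField →+* E.FunctionField) :
    Prop where
  const : ∀ c, Φ (constHom X c) = constHom E c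
  hasValue_localCoord : ∀ P i, HasValue P (Φ (localCoord (ψ P) i)) 0

/-- The map `ψ` is given by the functions `f` in homogeneous coordinates. -/
def IsGivenBy (ψ : E.Point → X.Point) (f : Fin 3 → E.FunctionField) : Prop :=
  ∀ P, ∃ g : E.FunctionField, ∀ i, HasValue P (g * f i) (homCoord (ψ P) i)

theorem IsGivenBy.hasValue_of_eq_some {ψ : E.Point → X.Point} {f : Fin 3 → E.FunctionField}
    (hf : IsGivenBy ψ f) {P : E.Point} {x y : ℂ} {h : X.Nonsingular x y}
    (hP : ψ P = Point.some x y h) :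
    f 2 ≠ 0 ∧ HasValue P (f 0 / f 2) x ∧ HasValue P (f 1 / f 2) y := by
  obtain ⟨g, hg⟩ := hf P
  have hj : homCoord (ψ P) 2 = 1 := by rw [hP]; rfl
  have h0 := hasValue_div_of_homCoord hg hj 0
  have h1 := hasValue_div_of_homCoord hg hj 1
  rw [hP] at h0 h1
  exact ⟨h0.1, h0.2, h1.2⟩

theorem IsGivenBy.hasValue_of_eq_zero {ψ : E.Point → X.Point} {f : Fin 3 → E.FunctionField}
    (hf : IsGivenBy ψ f) {P : E.Point} (hP : ψ P = 0) :
    f 1 ≠ 0 ∧ HasValue P (f 0 / f 1) 0 ∧ HasValue P (f 2 / f 1) 0 := by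
  obtain ⟨g, hg⟩ := hf P
  have hj : homCoord (ψ P) 1 = 1 := by rw [hP]; rfl
  have h0 := hasValue_div_of_homCoord hg hj 0
  have h2 := hasValue_div_of_homCoord hg hj 2
  rw [hP] at h0 h2
  exact ⟨h0.1, h0.2, h2.2⟩

/-- The kernel consists of zeros of `f 2 / f 1`. A point outside it gives `f 2 ≠ 0`, the identity
gives `f 1 ≠ 0`. -/
theorem IsGivenBy.finite_ker {ψ : E.Point →+ X.Point} {f : Fin 3 → E.FunctionField}
    (hf : IsGivenBy ψ f) (hne : ψ ≠ 0) : {P | ψ P = 0}.Finite := by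
  obtain ⟨P, hP⟩ : ∃ P, ψ P ≠ 0 := by
    contrapose! hne
    exact AddMonoidHom.ext hne
  have h2 : f 2 ≠ 0 := by
    rcases hQ : ψ P with _ | ⟨x, y, h⟩
    · exact absurd hQ hP
    · exact (hf.hasValue_of_eq_some hQ).1
  have h1 : f 1 ≠ 0 := (hf.hasValue_of_eq_zero (map_zero ψ)).1
  by_contra hinf
  refine div_ne_zero h2 h1 (eq_zero_of_infinite (Set.Infinite.mono (fun P hP => ?_) hinf))
  exact hasValue_zero_iff.1 (hf.hasValue_of_eq_zero hP).2.2

theorem finite_preimage_of_finite_ker {ψ : E.Point →+ X.Point} (hψ : {P | ψ P = 0}.Finite)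
    {S : Set X.Point} (hS : S.Finite) : (ψ ⁻¹' S).Finite := by
  refine hS.preimage' fun Q _ => ?_
  rcases Set.eq_empty_or_nonempty (ψ ⁻¹' {Q}) with h | ⟨P, hP⟩
  · rw [h]; exact Set.finite_empty
  · refine (hψ.image (P + ·)).subset fun P' hP' => ⟨P' - P, ?_, by simp⟩
    rw [Set.mem_preimage, Set.mem_singleton_iff] at hP hP'
    simp [hP, hP']

/-- Both sides agree at the infinitely many points outside the kernel, hence as functions. -/
theorem IsGivenBy.equation [E.IsElliptic] {ψ : E.Point →+ X.Point} {f : Fin 3 → E.FunctionField}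
    (hf : IsGivenBy ψ f) (hψ : {P | ψ P = 0}.Finite) :
    (f 1 / f 2) ^ 2 + constHom E X.a₁ * (f 0 / f 2) * (f 1 / f 2) + constHom E X.a₃ * (f 1 / f 2) =
      (f 0 / f 2) ^ 3 + constHom E X.a₂ * (f 0 / f 2) ^ 2 + constHom E X.a₄ * (f 0 / f 2) +
        constHom E X.a₆ := by
  rw [← sub_eq_zero]
  refine eq_zero_of_infinite (Set.Infinite.mono (fun P hP => ?_) hψ.infinite_compl)
  rcases hQ : ψ P with _ | ⟨x, y, h⟩
  · exact absurd hQ hP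
  · obtain ⟨-, hx, hy⟩ := hf.hasValue_of_eq_some hQ
    have hc := hasValue_const P
    have := (((hy.pow 2).add (((hc X.a₁).mul hx).mul hy)).add ((hc X.a₃).mul hy)).sub
      ((((hx.pow 3).add ((hc X.a₂).mul (hx.pow 2))).add ((hc X.a₄).mul hx)).add (hc X.a₆))
    rw [(equation_iff' x y).1 h.1] at this
    exact hasValue_zero_iff.1 this

/-- A non-constant isogeny induces a pullback of functions. -/
theorem IsGivenBy.exists_isPullback [E.IsElliptic] [X.IsElliptic] {ψ : E.Point →+ X.Point}
    {f : Fin 3 → E.FunctionField} (hf : IsGivenBy ψ f) (hψ : {P | ψ P = 0}.Finite) :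
    ∃ Φ : X.FunctionField →+* E.FunctionField, IsPullback ψ Φ := by
  have heq := hf.equation hψ
  have hval {P : E.Point} {x y : ℂ} {h : X.Nonsingular x y} (hP : ψ P = Point.some x y h)
      (a : X.CoordinateRing) : HasValue P (coordLift _ _ _ heq a) (evalPoint h.1 a) := by
    obtain ⟨-, hx, hy⟩ := hf.hasValue_of_eq_some hP
    induction a using coordinateRing_induction with
    | const c => simp only [evalPoint, coordLift_const]; exact hasValue_const P c
    | x => simpa only [evalPoint, coordLift_x] using hx
    | y => simpa only [evalPoint, coordLift_y] using hy
    | add a b ha hb => rw [map_add, map_add]; exact ha.add hb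
    | mul a b ha hb => rw [map_mul, map_mul]; exact ha.mul hb
  -- If a pulls back to 0, it vanishes at every affine `ψ P`. Were its zeros finite in number,
  -- finite fibres would make E finite.
  have hinj : Function.Injective (coordLift _ _ _ heq) := by
    refine (injective_iff_map_eq_zero _).2 fun a ha => ?_
    rw [← IsFractionRing.to_map_eq_zero_iff (K := X.FunctionField)]
    refine eq_zero_of_infinite fun hfin => ?_
    refine Set.infinite_univ ((finite_preimage_of_finite_ker hψ
      (hfin.union (Set.finite_singleton 0))).subset fun P _ => ?_)
    rcases hQ : ψ P with _ | ⟨x, y, h⟩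
    · exact Or.inr hQ
    · have h1 := hval hQ a
      rw [ha] at h1
      have h2 := hasValue_algebraMap h a
      rw [h1.unique (hasValue_zero_iff.2 ⟨zero_mem _, zero_mem _⟩), hasValue_zero_iff] at h2
      refine Or.inl ?_
      rw [hQ]
      exact h2
  have hΦ (a : X.CoordinateRing) : IsFractionRing.lift hinj (algebraMap _ X.FunctionField a) =
    coordLift _ _ _ heq a := IsFractionRing.lift_algebraMap hinj a
  have hx : IsFractionRing.lift hinj (xFun X) = f 0 / f 2 := (hΦ _).trans (coordLift_x ..)
  have hy : IsFractionRing.lift hinj (yFun X) = f 1 / f 2 := (hΦ _).trans (coordLift_y ..)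
  have hc (c : ℂ) : IsFractionRing.lift hinj (constHom X c) = constHom E c :=
    (hΦ _).trans (coordLift_const ..)
  refine ⟨IsFractionRing.lift hinj, hc, fun P i => ?_⟩
  rcases hQ : ψ P with _ | ⟨x, y, h⟩
  · obtain ⟨h1, h0, h2⟩ := hf.hasValue_of_eq_zero hQ
    obtain ⟨P', hP'⟩ := hψ.infinite_compl.nonempty
    have h2' : f 2 ≠ 0 := by
      rcases hQ' : ψ P' with _ | ⟨x, y, h⟩
      · exact absurd hQ' hP'
      · exact (hf.hasValue_of_eq_some hQ').1
    fin_cases i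
    · change HasValue P (IsFractionRing.lift hinj (xFun X / yFun X)) 0
      rwa [map_div₀, hx, hy, div_div_div_cancel_right₀ h2']
    · change HasValue P (IsFractionRing.lift hinj (1 / yFun X)) 0
      rwa [map_div₀, hy, map_one, one_div_div]
  · obtain ⟨-, h0, h1⟩ := hf.hasValue_of_eq_some hQ
    fin_cases i
    · change HasValue P (IsFractionRing.lift hinj (xFun X - constHom X x)) 0
      rw [map_sub, hx, hc]
      simpa using h0.sub (hasValue_const P x)
    · change HasValue P (IsFractionRing.lift hinj (yFun X - constHom X y)) 0
      rw [map_sub, hy, hc]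
      simpa using h1.sub (hasValue_const P y)

/-! ### Values and differentials under pullback -/

namespace IsPullback

variable {ψ : E.Point → X.Point} {Φ : X.FunctionField →+* E.FunctionField}

theorem hasValue (h : IsPullback ψ Φ) {P : E.Point} {r : X.FunctionField} {c : ℂ}
    (hr : HasValue (ψ P) r c) : HasValue P (Φ r) c := by
  have hp (p : MvPolynomial (Fin 2) ℂ) :
      HasValue P (Φ (polyFun (ψ P) p)) (MvPolynomial.eval 0 p) := by
    induction p using MvPolynomial.induction_on with
    | C c => rw [polyFun_C, MvPolynomial.eval_C, h.const]; exact hasValue_const P c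
    | add p q hp hq => simp only [map_add]; exact hp.add hq
    | mul_X p i hp =>
      rw [map_mul, map_mul, map_mul, polyFun_X, MvPolynomial.eval_X]
      exact hp.mul (h.hasValue_localCoord P i)
  obtain ⟨p, q, hq, rfl⟩ := mem_localRing_iff.1 hr.mem
  rw [hr.unique ((hasValue_polyFun _ p).div (hasValue_polyFun _ q) hq), map_div₀]
  exact (hp p).div (hp q) hq

theorem value_eq [X.IsElliptic] (h : IsPullback ψ Φ) (r : X.FunctionField) (P : E.Point) :
    value (Φ r) P = value r (ψ P) := by
  rcases hv : value r (ψ P) with _ | c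
  · change value r (ψ P) = ∞ at hv
    change value (Φ r) P = ∞
    rw [value_eq_infty_iff] at hv ⊢
    -- If `Φ r` were regular at `P`, its product with the pullback of 1/r, which vanishes there,
    -- would be 1 with value 0.
    intro hmem
    obtain ⟨d, hd⟩ := exists_hasValue hmem
    have h1 := hd.mul (h.hasValue (hasValue_zero_iff.2 (inPow_inv_of_notMem hv)))
    have hr : r ≠ 0 := fun h => hv (h ▸ zero_mem _)
    rw [← map_mul, mul_inv_cancel₀ hr, map_one, ← map_one (constHom E), mul_zero] at h1
    exact one_ne_zero ((hasValue_const P 1).unique h1)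
  · exact value_eq_coe_iff.2 (h.hasValue (value_eq_coe_iff.1 hv))

/-- The pullback of the invariant differential is a multiple of the invariant differential. -/
theorem exists_invDeriv_eq (h : IsPullback ψ Φ) :
    ∃ g : E.FunctionField, ∀ r, invDeriv E (Φ r) = g * Φ (invDeriv X r) := by
  have hX : derivX X ≠ 0 := by
    have h1 : derivX X = algebraMap _ _ ((Polynomial.C X.a₁ * Polynomial.X + Polynomial.C X.a₃) •
        (1 : X.CoordinateRing) + (Polynomial.C (2 : ℂ)) • CoordinateRing.mk X Polynomial.X) := by
      rw [CoordinateRing.smul, CoordinateRing.smul]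
      simp only [map_add, map_mul, mul_one, derivX, constHom, xFun, yFun, RingHom.comp_apply]
      ring
    rw [h1, Ne, IsFractionRing.to_map_eq_zero_iff]
    intro h2
    have h3 := (CoordinateRing.smul_basis_eq_zero h2).2
    rw [Polynomial.C_eq_zero] at h3
    exact two_ne_zero h3
  have hX' : Φ (derivX X) ≠ 0 := (map_ne_zero Φ).2 hX
  -- Differentiating the pulled-back Weierstrass equation makes the ratio g obtained from x agree
  -- with the one obtained from y.
  have hxy : invDeriv E (Φ (yFun X)) * Φ (derivX X) =
      invDeriv E (Φ (xFun X)) * Φ (derivY X) := by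
    have h1 := congrArg (fun r => invDeriv E (Φ r)) (equation_fun X)
    simp only [map_add, map_mul, map_pow, h.const, invDeriv_mul, invDeriv_const,
      Derivation.leibniz_pow, nsmul_eq_mul, smul_eq_mul] at h1
    simp only [derivX, derivY, map_add, map_sub, map_mul, map_pow, h.const, map_ofNat]
    push_cast at h1
    linear_combination h1
  refine ⟨invDeriv E (Φ (xFun X)) / Φ (derivX X), fun r => ?_⟩
  induction r using functionField_induction with
  | const c => rw [constFun_eq, h.const, invDeriv_const, invDeriv_const, map_zero, mul_zero]
  | x => rw [invDeriv_x, div_mul_cancel₀ _ hX']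
  | y => rw [invDeriv_y, div_mul_eq_mul_div, eq_div_iff hX', hxy]
  | add r s hr hs => simp only [map_add, hr, hs, mul_add]
  | mul r s hr hs =>
    simp only [map_mul, map_add, invDeriv_mul, hr, hs]
    ring
  | inv r hr =>
    rw [map_inv₀, Derivation.leibniz_inv, Derivation.leibniz_inv, hr]
    simp only [smul_eq_mul, map_mul, map_neg, map_pow, map_inv₀]
    ring

/-- The pullback of the invariant differential is a nonzero constant multiple of the invariant
differential. -/
theorem exists_invDeriv_eq_const [E.IsElliptic] [X.IsElliptic] (h : IsPullback ψ Φ) :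
    ∃ k : ℂ, k ≠ 0 ∧ ∀ r, invDeriv E (Φ r) = constHom E k * Φ (invDeriv X r) := by
  obtain ⟨g, hg⟩ := h.exists_invDeriv_eq
  obtain ⟨k, rfl⟩ : ∃ k, g = constHom E k := by
    -- Near `P`, g is D(Φ t) / Φ(D t) for a uniformizer t at `ψ P`, and this denominator does not
    -- vanish at `P`.
    refine exists_eq_const_of_regular fun P => ?_
    obtain ⟨t, c, ht, htd, hc⟩ := exists_invDeriv_ne_zero (ψ P)
    have h1 := h.hasValue htd
    have h2 := invDeriv_mem (h.hasValue (hasValue_zero_iff.2 ht)).mem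
    have h3 : g = invDeriv E (Φ t) * (Φ (invDeriv X t))⁻¹ := by
      rw [hg, mul_inv_cancel_right₀ (h1.ne_zero hc)]
    rw [h3]
    exact mul_mem h2 (h1.inv hc).mem
  refine ⟨k, ?_, hg⟩
  -- If k were 0, the pullback of a uniformizer would have zero derivative and a zero, hence vanish,
  -- against injectivity of `Φ`.
  rintro rfl
  obtain ⟨t, c, ht, htd, hc⟩ := exists_invDeriv_ne_zero (ψ 0)
  have h1 : Φ t = 0 := by
    refine eq_zero_of_invDeriv_eq_zero
      (hasValue_zero_iff.1 (h.hasValue (hasValue_zero_iff.2 ht))) ?_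
    rw [hg, map_zero, zero_mul]
  rw [(map_eq_zero Φ).1 h1, map_zero] at htd
  exact htd.ne_zero hc rfl

/-- A morphism between elliptic curves is unramified. -/
theorem inPow_two [E.IsElliptic] [X.IsElliptic] (h : IsPullback ψ Φ) {P : E.Point}
    {r : X.FunctionField} (hr : InPow (ψ P) 1 r) (hΦ : InPow P 2 (Φ r)) : InPow (ψ P) 2 r := by
  obtain ⟨k, hk, hd⟩ := h.exists_invDeriv_eq_const
  obtain ⟨c, hc⟩ := exists_hasValue (invDeriv_mem hr.mem)
  have h1 := (hasValue_const P k).mul (h.hasValue hc)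
  rw [← hd] at h1
  have h2 := h1.unique (hasValue_zero_iff.2 hΦ.invDeriv)
  rw [(mul_eq_zero.1 h2).resolve_left hk] at hc
  exact inPow_two_of_invDeriv hr (hasValue_zero_iff.1 hc)

end IsPullback

/-! ### Toroidal Belyĭ pairs -/

theorem two_le_vanishingOrder_iff {P : E.Point} {r : E.FunctionField} :
    2 ≤ vanishingOrder P r ↔ InPow P 2 r := by
  refine ⟨fun h => ?_, fun h => le_iSup_of_le ⟨2, h⟩ le_rfl⟩
  by_contra hr
  have : vanishingOrder P r ≤ 1 := by
    refine iSup_le fun ⟨e, he⟩ => ?_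
    have : e ≤ 1 := by
      by_contra h1
      exact hr (he.mono (by omega))
    exact_mod_cast this
  exact absurd (h.trans this) (by decide)

/-- Poles are set aside by inserting ∞, so ramification is compared only at finite values. -/
theorem IsPullback.criticalValues_subset [E.IsElliptic] [X.IsElliptic] {ψ : E.Point → X.Point}
    {Φ : X.FunctionField →+* E.FunctionField} (h : IsPullback ψ Φ) (r : X.FunctionField) :
    criticalValues (Φ r) ⊆ insert ∞ (criticalValues r) := by
  rintro q ⟨P, hP, rfl⟩
  rw [ramificationIndex] at hP
  rw [h.value_eq] at hP ⊢
  rcases hv : value r (ψ P) with _ | c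
  · exact Or.inl rfl
  · refine Or.inr ⟨ψ P, ?_, hv⟩
    rw [hv] at hP
    rw [ramificationIndex, hv]
    change 2 ≤ vanishingOrder _ (r - constHom X c)
    change 2 ≤ vanishingOrder _ (Φ r - constHom E c) at hP
    rw [two_le_vanishingOrder_iff] at hP ⊢
    rw [← h.const, ← map_sub] at hP
    exact h.inPow_two (value_eq_coe_iff.1 hv) hP

/-- A function taking some value at infinitely many points is constant. -/
theorem value_eq_of_infinite [E.IsElliptic] {r : E.FunctionField} {q : OnePoint ℂ}
    (h : {P : E.Point | value r P = q}.Infinite) (P : E.Point) : value r P = q := by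
  rcases q with _ | c
  · have h0 : r⁻¹ = 0 := eq_zero_of_infinite (h.mono fun P hP =>
      inPow_inv_of_notMem (value_eq_infty_iff.1 hP))
    obtain ⟨Q, hQ⟩ := h.nonempty
    refine absurd ?_ (value_eq_infty_iff.1 hQ)
    rw [inv_eq_zero.1 h0]
    exact zero_mem _
  · have h0 : r - constHom E c = 0 := eq_zero_of_infinite (h.mono fun P hP =>
      value_eq_coe_iff.1 hP)
    rw [sub_eq_zero.1 h0]
    exact value_eq_coe_iff.2 (hasValue_const P c)

end

end ToroidalBelyi

theorem mainTheorem1 (E X : WeierstrassCurve.Affine ℂ) [E.IsElliptic] [X.IsElliptic]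
    (φ : X.Point → OnePoint ℂ) (hφ : ToroidalBelyi.IsToroidalBelyiPair X φ)
    (ψ : E.Point → X.Point) (hψ : ToroidalBelyi.IsIsogeny E X ψ)
    (hne : ∃ P Q : E.Point, ψ P ≠ ψ Q) :
    ToroidalBelyi.IsToroidalBelyiPair E (φ ∘ ψ) ∧
    (ToroidalBelyi.quasiCriticalSet φ ⊆ (AddCommGroup.torsion X.Point : Set X.Point) →
      ToroidalBelyi.quasiCriticalSet (φ ∘ ψ) ⊆ (AddCommGroup.torsion E.Point : Set E.Point)) ∧
    ((∃ H : AddSubgroup X.Point, (H : Set X.Point) = ToroidalBelyi.quasiCriticalSet φ) →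
      ToroidalBelyi.quasiCriticalSet (φ ∘ ψ) = ψ ⁻¹' ToroidalBelyi.quasiCriticalSet φ ∧
      ∃ K : AddSubgroup E.Point, (K : Set E.Point) = ToroidalBelyi.quasiCriticalSet (φ ∘ ψ)) := by
  obtain ⟨⟨f, hf : ToroidalBelyi.IsGivenBy ψ f⟩, hadd⟩ := hψ
  obtain ⟨ψ, rfl⟩ : ∃ ψ' : E.Point →+ X.Point, ψ = ψ' := ⟨AddMonoidHom.mk' ψ hadd, rfl⟩
  have hker : {P | ψ P = 0}.Finite := hf.finite_ker (by
    rintro rfl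
    obtain ⟨P, Q, h⟩ := hne
    exact h rfl)
  obtain ⟨Φ, hΦ⟩ := hf.exists_isPullback hker
  obtain ⟨⟨P₁, P₂, hP⟩, r, hr, hcrit⟩ := hφ
  refine ⟨⟨?_, Φ r, fun P => (hΦ.value_eq r P).trans (hr _), ?_⟩, fun htors P hP => ?_, ?_⟩
  -- If `φ ∘ ψ` were constant, one fibre of `φ` would have all of E as preimage; by finite fibres of
  -- `ψ` it is infinite, so `φ` would be constant.
  · by_contra! hconst
    have hinf : {Q | ToroidalBelyi.value r Q = φ (ψ 0)}.Infinite := fun hfin =>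
      Set.infinite_univ ((ToroidalBelyi.finite_preimage_of_finite_ker hker hfin).subset
        fun P _ => (hr _).trans (hconst P 0))
    have := ToroidalBelyi.value_eq_of_infinite hinf
    exact hP (by rw [← hr, ← hr, this, this])
  · refine (hΦ.criticalValues_subset r).trans (Set.insert_subset ?_ hcrit)
    exact Or.inr (Or.inr rfl)
  · have h1 : ψ P ∈ AddCommGroup.torsion X.Point := htors hP
    change IsOfFinAddOrder (ψ P) at h1
    change IsOfFinAddOrder P
    have : Finite ψ.ker := hker
    obtain ⟨n, hn, h2⟩ := h1.exists_nsmul_eq_zero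
    -- A positive multiple of `P` lies in the finite kernel, so it has finite order, and so does
    -- `P`.
    have h3 : n • P ∈ ψ.ker := by rw [AddMonoidHom.mem_ker, map_nsmul, h2]
    have h4 : IsOfFinAddOrder (n • P) := by
      have := isOfFinAddOrder_of_finite (⟨_, h3⟩ : ψ.ker)
      exact (ψ.ker.subtype).isOfFinAddOrder this
    exact (isOfFinAddOrder_nsmul.1 h4).resolve_right hn.ne'
  · rintro ⟨H, hH⟩
    refine ⟨rfl, H.comap ψ, ?_⟩
    rw [AddSubgroup.coe_comap, hH]
    rfl
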